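/- Let $n\ge 1$, $\alpha\in(0,1)$ and $Q=(0,1)^n$. For $\varphi\in C_c^\infty(\mathbb{R}^n)$ put $$\nabla^\alpha\varphi(x)=\mu_{n,\alpha}\int_{\mathbb{R}^n}\frac{\varphi(y)-\varphi(x)}{|y-x|^{n+\alpha}}\,\frac{y-x}{|y-x|}\,dy,\qquad \mu_{n,\alpha}=2^{\alpha}\pi^{-n/2}\,\frac{\Gamma((n+\alpha+1)/2)}{\Gamma((1-\alpha)/2)}.$$ For $u\in L^1(\mathbb{R}^n)+L^\infty(\mathbb{R}^n)$, a field $w\in L^1_{loc}(\mathbb{R}^n;\mathbb{R}^n)$ is called the weak $\alpha$-fractional gradient of $u$, written $w=\nabla^\alpha u$, if $\int_{\mathbb{R}^n} w\,\varphi\,dx=-\int_{\mathbb{R}^n} u\,\nabla^\alpha\varphi\,dx$ for all $\varphi\in C_c^\infty(\mathbb{R}^n)$. Let $S^{\alpha,\infty}_{per}(Q)$ be the set of real-valued $u\in L^\infty(\mathbb{R}^n)$ that have a weak $\alpha$-fractional gradient in $L^\infty(\mathbb{R}^n;\mathbb{R}^n)$ and are $Q$-periodic, i.e. $u(x+e_i)=u(x)$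 for a.e. $x\in\mathbb{R}^n$ and every standard unit vector $e_i$, $i=1,\dots,n$. Let $W^{1,\infty}_{per}(Q)$ be the set of real-valued $v\in W^{1,\infty}(\mathbb{R}^n)$ that are $Q$-periodic in the same sense (equivalently, up to modification on a null set, the $Q$-periodic Lipschitz functions on $\mathbb{R}^n$), and let $\nabla v$ denote the usual weak gradient of $v$. Then: 1. for every $v\in W^{1,\infty}_{per}(Q)$ there exists $u\in S^{\alpha,\infty}_{per}(Q)$ such that $\nabla^\alpha u=\nabla v$ a.e. on $\mathbb{R}^n$; 2. conversely, for every $u\in S^{\alpha,\infty}_{per}(Q)$ there exists $v\in W^{1,\infty}_{per}(Q)$ such that $\nabla^\alpha u=\nabla v$ a.e. on $\mathbb{R}^n$. -/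

import Mathlib

open MeasureTheory
open scoped ENNReal ContDiff

noncomputable section

namespace FractionalGradient

/-- `φ ∈ C_c^∞(ℝⁿ)`. -/
def IsTestFunction {n : ℕ} (φ : EuclideanSpace ℝ (Fin n) → ℝ) : Prop :=
  ContDiff ℝ ∞ φ ∧ HasCompactSupport φ

/-- The normalizing constant
`μ_{n,α} = 2^α π^{-n/2} Γ((n+α+1)/2) / Γ((1-α)/2)`. -/
def rieszGradientConst (n : ℕ) (α : ℝ) : ℝ :=
  (2 : ℝ) ^ α * Real.pi ^ (-((n : ℝ) / 2)) *
    (Real.Gamma (((n : ℝ) + α + 1) / 2) / Real.Gamma ((1 - α) / 2))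

/-- The Riesz fractional gradient of order `α` (for `α ∈ (0,1)` and `φ` bounded and Lipschitz, the
integrand is integrable for every `x`):
`∇^α φ(x) = μ_{n,α} ∫ (φ(y) - φ(x)) / |y - x|^{n+α} · (y - x) / |y - x| dy`. -/
def rieszGradient {n : ℕ} (α : ℝ) (φ : EuclideanSpace ℝ (Fin n) → ℝ)
    (x : EuclideanSpace ℝ (Fin n)) : EuclideanSpace ℝ (Fin n) :=
  rieszGradientConst n α •
    ∫ y, ((φ y - φ x) / ‖y - x‖ ^ ((n : ℝ) + α)) • (‖y - x‖⁻¹ • (y - x))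

/-- `u ∈ L¹(ℝⁿ) + L^∞(ℝⁿ)`. -/
def MemL1AddLinfty {n : ℕ} (u : EuclideanSpace ℝ (Fin n) → ℝ) : Prop :=
  ∃ u₁ u₂ : EuclideanSpace ℝ (Fin n) → ℝ,
    MemLp u₁ 1 volume ∧ MemLp u₂ ∞ volume ∧ u =ᵐ[volume] u₁ + u₂

/-- `w` is (a representative of) the weak `α`-fractional Riesz gradient of
`u ∈ L¹(ℝⁿ) + L^∞(ℝⁿ)`: `w ∈ L¹_loc(ℝⁿ; ℝⁿ)` and `∫ w φ = - ∫ u ∇^α φ` for all test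
functions `φ`. -/
def HasWeakRieszGradient {n : ℕ} (α : ℝ) (u : EuclideanSpace ℝ (Fin n) → ℝ)
    (w : EuclideanSpace ℝ (Fin n) → EuclideanSpace ℝ (Fin n)) : Prop :=
  MemL1AddLinfty u ∧ LocallyIntegrable w volume ∧
    ∀ φ : EuclideanSpace ℝ (Fin n) → ℝ, IsTestFunction φ →
      ∫ x, φ x • w x = -∫ x, u x • rieszGradient α φ x

/-- `g` is (a representative of) the classical weak gradient of `v ∈ L¹_loc(ℝⁿ)`:
`g ∈ L¹_loc(ℝⁿ; ℝⁿ)` and `∫ g φ = - ∫ v ∇φ` for all test functions `φ`. -/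
def HasWeakGradient {n : ℕ} (v : EuclideanSpace ℝ (Fin n) → ℝ)
    (g : EuclideanSpace ℝ (Fin n) → EuclideanSpace ℝ (Fin n)) : Prop :=
  LocallyIntegrable v volume ∧ LocallyIntegrable g volume ∧
    ∀ φ : EuclideanSpace ℝ (Fin n) → ℝ, IsTestFunction φ →
      ∫ x, φ x • g x = -∫ x, v x • gradient φ x

/-- Membership in the fractional Sobolev space `S^{α,p}(ℝⁿ)`. -/
def MemS {n : ℕ} (α : ℝ) (p : ℝ≥0∞) (u : EuclideanSpace ℝ (Fin n) → ℝ) : Prop :=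
  MemLp u p volume ∧
    ∃ w : EuclideanSpace ℝ (Fin n) → EuclideanSpace ℝ (Fin n),
      HasWeakRieszGradient α u w ∧ MemLp w p volume

/-- Membership in the Sobolev space `W^{1,p}(ℝⁿ)`. -/
def MemW1 {n : ℕ} (p : ℝ≥0∞) (v : EuclideanSpace ℝ (Fin n) → ℝ) : Prop :=
  MemLp v p volume ∧
    ∃ g : EuclideanSpace ℝ (Fin n) → EuclideanSpace ℝ (Fin n),
      HasWeakGradient v g ∧ MemLp g p volume

/-- `Q`-periodicity for the unit cube `Q = (0,1)ⁿ`, for functions determined up to null sets: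
`u(x + e_i) = u(x)` for almost every `x` and every standard unit vector `e_i`. -/
def IsUnitCubePeriodic {n : ℕ} (u : EuclideanSpace ℝ (Fin n) → ℝ) : Prop :=
  ∀ i : Fin n, ∀ᵐ x ∂(volume : Measure (EuclideanSpace ℝ (Fin n))),
    u (x + EuclideanSpace.single i 1) = u x

/-- `S^{α,∞}_per(Q)` with `Q = (0,1)ⁿ`. -/
def MemSInftyPer {n : ℕ} (α : ℝ) (u : EuclideanSpace ℝ (Fin n) → ℝ) : Prop :=
  MemS α ∞ u ∧ IsUnitCubePeriodic u

/-- `W^{1,∞}_per(Q)` with `Q = (0,1)ⁿ`. -/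
def MemW1InftyPer {n : ℕ} (v : EuclideanSpace ℝ (Fin n) → ℝ) : Prop :=
  MemW1 ∞ v ∧ IsUnitCubePeriodic v

/-- `∇^α u = ∇v` almost everywhere on `ℝⁿ`: both weak gradients exist, and they have a common
representative. -/
def RieszGradientEqGradient {n : ℕ} (α : ℝ) (u v : EuclideanSpace ℝ (Fin n) → ℝ) : Prop :=
  ∃ G : EuclideanSpace ℝ (Fin n) → EuclideanSpace ℝ (Fin n),
    HasWeakRieszGradient α u G ∧ HasWeakGradient v G

end FractionalGradient

end

/-!
Write `s = 1 - α` and `d` for the dimension. Both directions rest on the fact that the Riesz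
fractional gradient is `∇ I_s`, where `I_s` is the Riesz potential, with inverse the fractional
Laplacian of order `s / 2`. Since only existence is claimed, all operators are normalized up to
nonzero factors.

From `u` to `v`. The function `v x = c ∫ (K (y - x) - K y) u y dy` with `K z = ‖z‖ ^ (s - d)` is well
defined for bounded `u`, because the differences of `K` decay like `‖y‖ ^ (-d - α)`. Fubini's theorem
and `K * ∂ₑφ = c' (∇^α φ)ₑ` (`integral_potentialKernel_mul_fderiv`) show that `∇v = ∇^α u`. For the
periodicity of `v` let `D x = v (x + e) - v x` with a period `e` of `u`. Then `D` is `e`-periodic, so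
`v (x + N e) - v x = N D x`, whereas by homogeneity of `K` the left side is `O(N ^ s)`; as `s < 1`,
`D = 0` (`potential_add_period`). A periodic and locally bounded function is bounded.

From `v` to `u`. Take `u = c ∫ (v (· + h) - v) ‖h‖ ^ (-d - s) dh`, a multiple of the fractional
Laplacian of `v` of order `s / 2`. It is bounded since `v` is bounded and Lipschitz
(`HasWeakGradient.ae_abs_sub_le`), and clearly periodic. The fractional Laplacian is symmetric
(`IsDifferenceKernel.integral_diffOp_mul`), so `∫ u ∇^α φ` is the integral of `v` against the
fractional Laplacian of `∇^α φ`, which is a nonzero multiple of `∇φ`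
(`exists_diffOp_laplaceKernel_diffOp_rieszKernel`). This last identity follows from Fourier inversion:
both operators integrate differences `f (x + h) - f x` against a homogeneous kernel, so they act by
multiplication with symbols, which are determined up to a factor by homogeneity and equivariance
under isometries. The factors do not vanish because the operators do not annihilate every bump
function.
-/

set_option linter.unusedSectionVars false

namespace FractionalGradient

open Set Filter Topology Module
open scoped FourierTransform

/-! ### Difference kernels -/

section Kernels

variable {E : Type*} [NormedAddCommGroup E] [InnerProductSpace ℝ E] [FiniteDimensional ℝ E]
  [MeasurableSpace E] [BorelSpace E]

/-- A kernel `κ : E → ℝ` with `∫ min 1 ‖h‖ * |κ h| < ∞`, so that differences `f (x + h) - f x` of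
bounded Lipschitz functions are integrable against it. -/
structure IsDifferenceKernel (κ : E → ℝ) : Prop where
  measurable : Measurable κ
  integrable : Integrable (fun h => min 1 ‖h‖ * |κ h|) volume

theorem integrableOn_min_one_mul_rpow {s : ℝ} (hs₀ : 0 < s) (hs₁ : s < 1) :
    IntegrableOn (fun r : ℝ => min 1 r * r ^ (-(1 + s))) (Ioi 0) := by
  rw [← Ioc_union_Ioi_eq_Ioi zero_le_one, integrableOn_union]
  constructor
  · have h : IntegrableOn (fun r : ℝ => r ^ (-s)) (Ioc 0 1) := by
      rw [integrableOn_Ioc_iff_integrableOn_Ioo]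
      exact (intervalIntegral.integrableOn_Ioo_rpow_iff zero_lt_one).2 (by linarith)
    refine h.congr_fun (fun r hr => ?_) measurableSet_Ioc
    have h0 : (0 : ℝ) < r := hr.1
    simp only [min_eq_right hr.2]
    rw [← Real.rpow_one_add' h0.le (by linarith)]
    congr 1; ring
  · have h : IntegrableOn (fun r : ℝ => r ^ (-(1 + s))) (Ioi 1) :=
      integrableOn_Ioi_rpow_of_lt (by linarith) zero_lt_one
    refine h.congr_fun (fun r hr => ?_) measurableSet_Ioi
    simp [min_eq_left (le_of_lt (mem_Ioi.1 hr))]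

variable [Nontrivial E]

theorem integrable_min_one_norm_mul_rpow {s : ℝ} (hs₀ : 0 < s) (hs₁ : s < 1) :
    Integrable (fun h : E => min 1 ‖h‖ * ‖h‖ ^ (-((finrank ℝ E : ℝ) + s))) volume := by
  rw [integrable_fun_norm_addHaar volume
    (f := fun r : ℝ => min 1 r * r ^ (-((finrank ℝ E : ℝ) + s)))]
  refine (integrableOn_min_one_mul_rpow hs₀ hs₁).congr_fun (fun r hr => ?_) measurableSet_Ioi
  have h0 : (0 : ℝ) < r := hr
  have hd : 1 ≤ finrank ℝ E := finrank_pos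
  simp only [smul_eq_mul]
  rw [← Real.rpow_natCast, mul_left_comm, ← Real.rpow_add h0]
  congr 2
  push_cast [hd]; ring

/-- Integrability of a homogeneous kernel of degree `> -d` over balls. -/
theorem integrable_indicator_norm_rpow {s : ℝ} (hs : 0 < s) (R : ℝ) :
    Integrable (fun z : E => (Iic R).indicator (fun r : ℝ => r ^ (s - (finrank ℝ E : ℝ))) ‖z‖)
      volume := by
  rw [integrable_fun_norm_addHaar volume
    (f := (Iic R).indicator (fun r : ℝ => r ^ (s - (finrank ℝ E : ℝ))))]
  have hd : 1 ≤ finrank ℝ E := finrank_pos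
  have h : IntegrableOn (fun r : ℝ => r ^ (s - 1)) (Ioc 0 (max R 1)) := by
    rw [integrableOn_Ioc_iff_integrableOn_Ioo]
    exact (intervalIntegral.integrableOn_Ioo_rpow_iff (by positivity)).2 (by linarith)
  have h2 : IntegrableOn ((Iic R).indicator fun r : ℝ => r ^ (s - 1)) (Ioi 0) := by
    rw [integrableOn_indicator_iff measurableSet_Iic]
    exact h.mono_set (fun r hr => ⟨hr.2, le_trans hr.1 (le_max_left _ _)⟩)
  refine h2.congr_fun (fun r hr => ?_) measurableSet_Ioi
  have h0 : (0 : ℝ) < r := hr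
  simp only [smul_eq_mul, indicator_apply]
  split_ifs
  · rw [← Real.rpow_natCast, ← Real.rpow_add h0]
    congr 1
    push_cast [hd]; ring
  · simp

/-- Integrability of a homogeneous kernel of degree `< -d` away from the origin. -/
theorem integrable_indicator_Ioi_norm_rpow {s : ℝ} (hs : 0 < s) {R : ℝ} (hR : 0 < R) :
    Integrable (fun z : E => (Ioi R).indicator (fun r : ℝ => r ^ (-((finrank ℝ E : ℝ) + s))) ‖z‖)
      volume := by
  rw [integrable_fun_norm_addHaar volume
    (f := (Ioi R).indicator (fun r : ℝ => r ^ (-((finrank ℝ E : ℝ) + s))))]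
  have hd : 1 ≤ finrank ℝ E := finrank_pos
  have h : IntegrableOn (fun r : ℝ => r ^ (-(1 + s))) (Ioi R) :=
    integrableOn_Ioi_rpow_of_lt (by linarith) hR
  have h2 : IntegrableOn ((Ioi R).indicator fun r : ℝ => r ^ (-(1 + s))) (Ioi 0) := by
    rw [integrableOn_indicator_iff measurableSet_Ioi]
    exact h.mono_set (fun r hr => hr.1)
  refine h2.congr_fun (fun r hr => ?_) measurableSet_Ioi
  have h0 : (0 : ℝ) < r := hr
  simp only [smul_eq_mul, indicator_apply]
  split_ifs
  · rw [← Real.rpow_natCast, ← Real.rpow_add h0]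
    congr 1
    push_cast [hd]; ring
  · simp

/-- The kernel `‖h‖^{-(d+s)}` of the fractional Laplacian of order `s/2`, up to a factor. -/
noncomputable def laplaceKernel (s : ℝ) (h : E) : ℝ := ‖h‖ ^ (-((finrank ℝ E : ℝ) + s))

/-- The component in direction `e` of the kernel `h / ‖h‖^{d+α+1}` of the Riesz fractional
gradient, up to a factor. -/
noncomputable def rieszKernel (α : ℝ) (e h : E) : ℝ :=
  ‖h‖ ^ (-((finrank ℝ E : ℝ) + α)) * (‖h‖⁻¹ * inner ℝ h e)

theorem isDifferenceKernel_laplaceKernel {s : ℝ} (hs₀ : 0 < s) (hs₁ : s < 1) :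
    IsDifferenceKernel (laplaceKernel s : E → ℝ) where
  measurable := by unfold laplaceKernel; fun_prop
  integrable := by
    refine (integrable_min_one_norm_mul_rpow (E := E) hs₀ hs₁).congr (.of_forall fun h => ?_)
    simp only [laplaceKernel]
    rw [abs_of_nonneg (by positivity)]

theorem abs_inv_norm_mul_inner_le {E : Type*} [NormedAddCommGroup E] [InnerProductSpace ℝ E]
    (h e : E) : |‖h‖⁻¹ * inner ℝ h e| ≤ ‖e‖ := by
  rcases eq_or_ne h 0 with rfl | hh
  · simp
  · have h0 : 0 < ‖h‖ := norm_pos_iff.2 hh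
    rw [abs_mul, abs_of_nonneg (by positivity : 0 ≤ ‖h‖⁻¹), inv_mul_le_iff₀ h0]
    exact abs_real_inner_le_norm h e

theorem isDifferenceKernel_rieszKernel {α : ℝ} (hα₀ : 0 < α) (hα₁ : α < 1) (e : E) :
    IsDifferenceKernel (rieszKernel α e) where
  measurable := by unfold rieszKernel; fun_prop
  integrable := by
    refine ((integrable_min_one_norm_mul_rpow (E := E) hα₀ hα₁).mul_const ‖e‖).mono' ?_
      (.of_forall fun h => ?_)
    · unfold rieszKernel; fun_prop
    · have h1 := abs_inv_norm_mul_inner_le h e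
      simp only [rieszKernel]
      rw [Real.norm_eq_abs, abs_mul, abs_abs, abs_mul (‖h‖ ^ _),
        abs_of_nonneg (by positivity : 0 ≤ min 1 ‖h‖),
        abs_of_nonneg (by positivity : 0 ≤ ‖h‖ ^ (-((finrank ℝ E : ℝ) + α))), mul_assoc]
      gcongr

end Kernels

/-! ### Translation-invariant difference operators and their symbols -/

section Symbols

variable {E : Type*} [NormedAddCommGroup E] [InnerProductSpace ℝ E] [FiniteDimensional ℝ E]
  [MeasurableSpace E] [BorelSpace E]

/-- The translation-invariant operator `f ↦ ∫ κ h (f (x + h) - f x) dh`. -/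
noncomputable def diffOp {F : Type*} [NormedAddCommGroup F] [NormedSpace ℝ F]
    (κ : E → ℝ) (f : E → F) (x : E) : F :=
  ∫ h, κ h • (f (x + h) - f x)

/-- The Fourier symbol of `diffOp κ`. -/
noncomputable def symbol (κ : E → ℝ) (ξ : E) : ℂ :=
  ∫ h, (κ h : ℂ) * ((𝐞 (inner ℝ h ξ) : ℂ) - 1)

theorem norm_fourierChar_sub_one_le (t : ℝ) : ‖(𝐞 t : ℂ) - 1‖ ≤ 2 * Real.pi * |t| := by
  rw [Real.fourierChar_apply]
  have h := Real.norm_exp_I_mul_ofReal_sub_one_le (x := 2 * Real.pi * t)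
  rw [Real.norm_eq_abs, abs_mul, abs_of_pos Real.two_pi_pos] at h
  rwa [mul_comm Complex.I] at h

theorem norm_fourierChar_inner_sub_one_le {E : Type*} [NormedAddCommGroup E]
    [InnerProductSpace ℝ E] (h ξ : E) :
    ‖(𝐞 (inner ℝ h ξ) : ℂ) - 1‖ ≤ 2 * Real.pi * (min 1 ‖h‖ * (1 + ‖ξ‖)) := by
  have hpi := Real.pi_gt_three
  rcases le_total 1 ‖h‖ with hh | hh
  · rw [min_eq_left hh]
    calc ‖(𝐞 (inner ℝ h ξ) : ℂ) - 1‖ ≤ ‖(𝐞 (inner ℝ h ξ) : ℂ)‖ + ‖(1 : ℂ)‖ := norm_sub_le _ _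
      _ = 2 := by rw [Circle.norm_coe, norm_one]; norm_num
      _ ≤ _ := by nlinarith [norm_nonneg ξ]
  · rw [min_eq_right hh]
    calc ‖(𝐞 (inner ℝ h ξ) : ℂ) - 1‖ ≤ 2 * Real.pi * |inner ℝ h ξ| :=
          norm_fourierChar_sub_one_le _
      _ ≤ 2 * Real.pi * (‖h‖ * (1 + ‖ξ‖)) := by
          gcongr
          nlinarith [abs_real_inner_le_norm h ξ, norm_nonneg h]

theorem measurable_fourierChar_coe : Measurable (fun t : ℝ => (𝐞 t : ℂ)) :=
  (continuous_subtype_val.comp Real.continuous_fourierChar).measurable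

theorem IsDifferenceKernel.integrable_symbol {κ : E → ℝ} (hκ : IsDifferenceKernel κ) (ξ : E) :
    Integrable (fun h => (κ h : ℂ) * ((𝐞 (inner ℝ h ξ) : ℂ) - 1)) volume := by
  refine (hκ.integrable.const_mul (2 * Real.pi * (1 + ‖ξ‖))).mono' ?_ (.of_forall fun h => ?_)
  · have := hκ.measurable
    have h2 := measurable_fourierChar_coe.comp (by fun_prop : Measurable fun h : E => inner ℝ h ξ)
    exact ((Complex.measurable_ofReal.comp this).mul (h2.sub_const 1)).aestronglyMeasurable
  · rw [norm_mul, Complex.norm_real, Real.norm_eq_abs]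
    calc |κ h| * ‖(𝐞 (inner ℝ h ξ) : ℂ) - 1‖
        ≤ |κ h| * (2 * Real.pi * (min 1 ‖h‖ * (1 + ‖ξ‖))) := by
          gcongr; exact norm_fourierChar_inner_sub_one_le h ξ
      _ = _ := by ring

theorem IsDifferenceKernel.norm_symbol_le {κ : E → ℝ} (hκ : IsDifferenceKernel κ) (ξ : E) :
    ‖symbol κ ξ‖ ≤ 2 * Real.pi * (∫ h, min 1 ‖h‖ * |κ h|) * (1 + ‖ξ‖) := by
  have : 2 * Real.pi * (∫ h, min 1 ‖h‖ * |κ h|) * (1 + ‖ξ‖)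
      = ∫ h, (2 * Real.pi * (1 + ‖ξ‖)) * (min 1 ‖h‖ * |κ h|) := by
    rw [integral_const_mul]; ring
  rw [this]
  refine norm_integral_le_of_norm_le (hκ.integrable.const_mul _) (.of_forall fun h => ?_)
  rw [norm_mul, Complex.norm_real, Real.norm_eq_abs]
  calc |κ h| * ‖(𝐞 (inner ℝ h ξ) : ℂ) - 1‖
      ≤ |κ h| * (2 * Real.pi * (min 1 ‖h‖ * (1 + ‖ξ‖))) := by
        gcongr; exact norm_fourierChar_inner_sub_one_le h ξ
    _ = _ := by ring

theorem IsDifferenceKernel.stronglyMeasurable_symbol {κ : E → ℝ} (hκ : IsDifferenceKernel κ) :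
    StronglyMeasurable (symbol κ) := by
  have hm := hκ.measurable
  have h2 : Measurable fun p : E × E => (𝐞 (inner ℝ p.2 p.1) : ℂ) :=
    measurable_fourierChar_coe.comp (by fun_prop : Measurable fun p : E × E => inner ℝ p.2 p.1)
  have h3 : Measurable fun p : E × E => (κ p.2 : ℂ) * ((𝐞 (inner ℝ p.2 p.1) : ℂ) - 1) :=
    (Complex.measurable_ofReal.comp (hm.comp measurable_snd)).mul (h2.sub_const 1)
  exact h3.stronglyMeasurable.integral_prod_right

/-- On a superposition `f = ∫ 𝐞⟪·, ξ⟫ a ξ dξ` of characters, `diffOp κ` acts by multiplying the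
amplitude `a` by the symbol of `κ`. -/
theorem IsDifferenceKernel.diffOp_fourierInv {κ : E → ℝ} (hκ : IsDifferenceKernel κ) {a : E → ℂ}
    (ha : AEStronglyMeasurable a volume)
    (ha' : Integrable (fun ξ => (1 + ‖ξ‖) * ‖a ξ‖) volume) (x : E) :
    diffOp κ (𝓕⁻ a) x = 𝓕⁻ (fun ξ => symbol κ ξ * a ξ) x := by
  have hchar : ∀ y : E, Measurable fun ξ : E => (𝐞 (inner ℝ ξ y) : ℂ) := fun y =>
    measurable_fourierChar_coe.comp (by fun_prop : Measurable fun ξ : E => inner ℝ ξ y)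
  have haI : Integrable a volume := by
    refine ha'.mono ha (.of_forall fun ξ => ?_)
    rw [Real.norm_eq_abs, abs_of_nonneg (by positivity)]
    nlinarith [norm_nonneg ξ, norm_nonneg (a ξ)]
  have hcI : ∀ y : E, Integrable (fun ξ => (𝐞 (inner ℝ ξ y) : ℂ) * a ξ) volume := fun y => by
    refine haI.mono ((hchar y).aestronglyMeasurable.mul ha) (.of_forall fun ξ => ?_)
    rw [norm_mul, Circle.norm_coe, one_mul]
  have hF : ∀ (b : E → ℂ) (y : E), 𝓕⁻ b y = ∫ ξ, (𝐞 (inner ℝ ξ y) : ℂ) * b ξ := fun b y => by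
    rw [Real.fourierInv_eq]; rfl
  have hprod : Integrable (fun p : E × E =>
      (κ p.1 : ℂ) * (((𝐞 (inner ℝ p.1 p.2) : ℂ) - 1) * ((𝐞 (inner ℝ p.2 x) : ℂ) * a p.2)))
      (volume.prod volume) := by
    refine ((hκ.integrable.mul_prod ha').const_mul (2 * Real.pi)).mono' ?_
      (.of_forall fun p => ?_)
    · have h2 : Measurable fun p : E × E => (𝐞 (inner ℝ p.1 p.2) : ℂ) :=
        measurable_fourierChar_coe.comp (by fun_prop : Measurable fun p : E × E => inner ℝ p.1 p.2)
      have h1 : Measurable fun p : E × E => (κ p.1 : ℂ) :=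
        Complex.measurable_ofReal.comp (hκ.measurable.comp measurable_fst)
      exact h1.aestronglyMeasurable.mul ((h2.sub_const 1).aestronglyMeasurable.mul
        ((((hchar x).aestronglyMeasurable.mul ha)).comp_snd))
    · rw [norm_mul, norm_mul, norm_mul, Complex.norm_real, Real.norm_eq_abs, Circle.norm_coe,
        one_mul]
      calc |κ p.1| * (‖(𝐞 (inner ℝ p.1 p.2) : ℂ) - 1‖ * ‖a p.2‖)
          ≤ |κ p.1| * ((2 * Real.pi * (min 1 ‖p.1‖ * (1 + ‖p.2‖))) * ‖a p.2‖) := by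
            gcongr; exact norm_fourierChar_inner_sub_one_le _ _
        _ = _ := by ring
  calc diffOp κ (𝓕⁻ a) x
      = ∫ h, ∫ ξ, (κ h : ℂ) *
          (((𝐞 (inner ℝ h ξ) : ℂ) - 1) * ((𝐞 (inner ℝ ξ x) : ℂ) * a ξ)) := by
        unfold diffOp
        congr 1; ext h
        rw [hF, hF, ← integral_sub (hcI _) (hcI _), integral_const_mul, Complex.real_smul]
        congr 2; ext ξ
        rw [inner_add_right, AddChar.map_add_eq_mul, Circle.coe_mul, real_inner_comm ξ h]
        ring
    _ = ∫ ξ, ∫ h, (κ h : ℂ) *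
          (((𝐞 (inner ℝ h ξ) : ℂ) - 1) * ((𝐞 (inner ℝ ξ x) : ℂ) * a ξ)) :=
        integral_integral_swap hprod
    _ = _ := by
        rw [hF]
        congr 1; ext ξ
        rw [symbol, ← integral_mul_const, ← integral_const_mul]
        congr 1; ext h
        ring

theorem symbol_comp_linearIsometryEquiv (κ : E → ℝ) (R : E ≃ₗᵢ[ℝ] E) (ξ : E) :
    symbol (κ ∘ R) ξ = symbol κ (R ξ) := by
  unfold symbol
  rw [← (R.measurePreserving).integral_comp R.toHomeomorph.measurableEmbedding
    (fun h => (κ h : ℂ) * ((𝐞 (inner ℝ h (R ξ)) : ℂ) - 1))]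
  simp

theorem symbol_smul_of_homogeneous {κ : E → ℝ} {s : ℝ}
    (hκ : ∀ r : ℝ, 0 < r → ∀ h, κ (r • h) = r ^ (-((finrank ℝ E : ℝ) + s)) * κ h)
    {r : ℝ} (hr : 0 < r) (ξ : E) : symbol κ (r • ξ) = ((r ^ s : ℝ) : ℂ) * symbol κ ξ := by
  have h := Measure.integral_comp_smul (volume : Measure E)
    (fun h => (κ h : ℂ) * ((𝐞 (inner ℝ h ξ) : ℂ) - 1)) r
  have h2 : (fun h : E => (κ (r • h) : ℂ) * ((𝐞 (inner ℝ (r • h) ξ) : ℂ) - 1)) =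
      fun h => ((r ^ (-((finrank ℝ E : ℝ) + s)) : ℝ) : ℂ) *
        ((κ h : ℂ) * ((𝐞 (inner ℝ h (r • ξ)) : ℂ) - 1)) := by
    ext h
    rw [hκ r hr, real_inner_smul_left, real_inner_smul_right]
    push_cast; ring
  rw [h2, integral_const_mul, abs_of_nonneg (by positivity), Complex.real_smul] at h
  change _ * symbol κ (r • ξ) = _ * symbol κ ξ at h
  have h3 : ((r ^ ((finrank ℝ E : ℝ) + s) : ℝ) : ℂ) *
      ((r ^ (-((finrank ℝ E : ℝ) + s)) : ℝ) : ℂ) = 1 := by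
    rw [← Complex.ofReal_mul, ← Real.rpow_add hr]; simp
  have h4 : r ^ ((finrank ℝ E : ℝ) + s) * (r ^ finrank ℝ E)⁻¹ = r ^ s := by
    rw [Real.rpow_add hr, Real.rpow_natCast]; field_simp
  calc symbol κ (r • ξ)
      = ((r ^ ((finrank ℝ E : ℝ) + s) : ℝ) : ℂ) *
        (((r ^ (-((finrank ℝ E : ℝ) + s)) : ℝ) : ℂ) * symbol κ (r • ξ)) := by
        rw [← mul_assoc, h3, one_mul]
    _ = _ := by rw [h, ← mul_assoc, ← Complex.ofReal_mul, h4]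

theorem conj_symbol (κ : E → ℝ) (ξ : E) : starRingEnd ℂ (symbol κ ξ) = symbol κ (-ξ) := by
  unfold symbol
  rw [← integral_conj]
  congr 1; ext h
  rw [map_mul, Complex.conj_ofReal, map_sub, map_one, ← Circle.coe_inv_eq_conj, inner_neg_right,
    AddChar.map_neg_eq_inv]

end Symbols

/-! ### The fractional Laplacian of the Riesz fractional gradient -/

section Composition

open scoped LineDeriv

variable {E : Type*} [NormedAddCommGroup E] [InnerProductSpace ℝ E] [FiniteDimensional ℝ E]
  [MeasurableSpace E] [BorelSpace E]

theorem ofReal_diffOp (κ : E → ℝ) (f : E → ℝ) (x : E) :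
    ((diffOp κ f x : ℝ) : ℂ) = diffOp κ (fun y => (f y : ℂ)) x := by
  unfold diffOp
  rw [← integral_complex_ofReal]
  congr 1; ext h
  simp

/-- A test function and its directional derivatives as superpositions of characters, with a rapidly
decreasing amplitude. -/
theorem exists_fourier_amplitude {φ : E → ℝ} (hφ : ContDiff ℝ ∞ φ) (hc : HasCompactSupport φ) :
    ∃ a : E → ℂ, Continuous a ∧ (∀ k : ℕ, Integrable (fun ξ => ‖ξ‖ ^ k * ‖a ξ‖) volume) ∧
      (fun x => (φ x : ℂ)) = 𝓕⁻ a ∧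
      ∀ e x, ((fderiv ℝ φ x e : ℝ) : ℂ) =
        𝓕⁻ (fun ξ => (2 * Real.pi * Complex.I * (inner ℝ ξ e : ℝ)) * a ξ) x := by
  have hφc : ContDiff ℝ ∞ (fun x => (φ x : ℂ)) := Complex.ofRealCLM.contDiff.comp hφ
  have hcc : HasCompactSupport (fun x => (φ x : ℂ)) := hc.comp_left (g := Complex.ofReal) rfl
  let Φ := hcc.toSchwartzMap hφc
  have hΦ : ∀ x, Φ x = (φ x : ℂ) := fun x => rfl
  let Ψ : SchwartzMap E ℂ := 𝓕 Φ
  refine ⟨Ψ, Ψ.continuous, fun k => Ψ.integrable_pow_mul volume k, ?_, fun e x => ?_⟩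
  · rw [← SchwartzMap.fourierInv_coe, FourierPair.fourierInv_fourier_eq]
    rfl
  · have h1 : ((fderiv ℝ φ x e : ℝ) : ℂ) = (∂_{e} Φ) x := by
      rw [SchwartzMap.lineDerivOp_apply_eq_fderiv]
      have h2 : HasFDerivAt (Φ : E → ℂ) (Complex.ofRealCLM.comp (fderiv ℝ φ x)) x :=
        Complex.ofRealCLM.hasFDerivAt.comp x (hφ.differentiable (by simp) x).hasFDerivAt
      rw [h2.fderiv]; simp
    have h3 : ((𝓕 (∂_{e} Φ) : SchwartzMap E ℂ) : E → ℂ) =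
        fun ξ => (2 * Real.pi * Complex.I * (inner ℝ ξ e : ℝ)) * Ψ ξ := by
      rw [SchwartzMap.fourier_lineDerivOp_eq]
      ext ξ
      have : (inner ℝ · e : E → ℝ).HasTemperateGrowth := ((innerSL ℝ).flip e).hasTemperateGrowth
      simp only [smul_apply, SchwartzMap.smulLeftCLM_apply_apply this, smul_eq_mul,
        Complex.real_smul]
      ring
    rw [h1, ← h3, ← SchwartzMap.fourierInv_coe, FourierPair.fourierInv_fourier_eq]

theorem integrable_one_add_norm_mul {b : E → ℂ}
    (h : ∀ k : ℕ, Integrable (fun ξ => ‖ξ‖ ^ k * ‖b ξ‖) volume) :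
    Integrable (fun ξ => (1 + ‖ξ‖) * ‖b ξ‖) volume := by
  refine ((h 0).add (h 1)).congr (.of_forall fun ξ => ?_)
  simp; ring

theorem IsDifferenceKernel.integrable_symbol_mul {κ : E → ℝ} (hκ : IsDifferenceKernel κ)
    {a : E → ℂ} (hac : AEStronglyMeasurable a volume)
    (h : ∀ k : ℕ, Integrable (fun ξ => ‖ξ‖ ^ k * ‖a ξ‖) volume) (k : ℕ) :
    Integrable (fun ξ => ‖ξ‖ ^ k * ‖symbol κ ξ * a ξ‖) volume := by
  refine (((h k).add (h (k + 1))).const_mul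
    (2 * Real.pi * ∫ h, min 1 ‖h‖ * |κ h|)).mono' ?_ (.of_forall fun ξ => ?_)
  · exact (by fun_prop : Measurable fun ξ : E => ‖ξ‖ ^ k).aestronglyMeasurable.mul
      (hκ.stronglyMeasurable_symbol.aestronglyMeasurable.mul hac).norm
  · have h1 := hκ.norm_symbol_le ξ
    rw [Real.norm_eq_abs, abs_of_nonneg (by positivity), norm_mul]
    simp only [Pi.add_apply]
    calc ‖ξ‖ ^ k * (‖symbol κ ξ‖ * ‖a ξ‖)
        ≤ ‖ξ‖ ^ k * ((2 * Real.pi * (∫ h, min 1 ‖h‖ * |κ h|) * (1 + ‖ξ‖)) * ‖a ξ‖) := by gcongr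
      _ = _ := by ring

/-- A kernel that is positive on some unit ball away from the origin has a nonzero symbol: the
operator does not annihilate a bump function supported in that ball. -/
theorem IsDifferenceKernel.exists_symbol_ne_zero {κ : E → ℝ} (hκ : IsDifferenceKernel κ) {p : E}
    (hp : 1 ≤ ‖p‖) (hpos : ∀ h ∈ Metric.ball p 1, 0 < κ h) : ∃ ξ, symbol κ ξ ≠ 0 := by
  by_contra! hcon
  let φ : ContDiffBump p := ⟨1 / 2, 1, by norm_num, by norm_num⟩
  obtain ⟨a, hac, hai, hfa, -⟩ := exists_fourier_amplitude (φ := φ) φ.contDiff φ.hasCompactSupport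
  have h0 : diffOp κ φ 0 = 0 := by
    have h := hκ.diffOp_fourierInv hac.aestronglyMeasurable (integrable_one_add_norm_mul hai) 0
    rw [← hfa, ← ofReal_diffOp, Real.fourierInv_eq] at h
    simpa [hcon] using h
  have hφ0 : φ 0 = 0 := φ.zero_of_le_dist (by simpa [dist_eq_norm] using hp)
  unfold diffOp at h0
  simp only [zero_add, hφ0, sub_zero, smul_eq_mul] at h0
  have hnn : 0 ≤ fun h => κ h * φ h := fun h => by
    by_cases hb : h ∈ Metric.ball p 1
    · exact mul_nonneg (hpos h hb).le φ.nonneg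
    · simp only [Pi.zero_apply]
      rw [φ.zero_of_le_dist (by simpa using hb), mul_zero]
  have hint : Integrable (fun h => κ h * φ h) volume := by
    obtain ⟨L, hL⟩ := (φ.contDiff (n := 1)).lipschitzWith_of_hasCompactSupport
      φ.hasCompactSupport (by simp)
    refine (hκ.integrable.const_mul (1 + L : ℝ)).mono'
      (hκ.measurable.mul φ.continuous.measurable).aestronglyMeasurable (.of_forall fun h => ?_)
    have h1 : ‖φ h‖ ≤ (1 + L) * min 1 ‖h‖ := by
      have h2 : ‖φ h‖ ≤ L * ‖h‖ := by
        have := hL.dist_le_mul h 0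
        rwa [dist_eq_norm, dist_eq_norm, hφ0, sub_zero, sub_zero] at this
      have h3 : ‖φ h‖ ≤ 1 := by
        rw [Real.norm_eq_abs, abs_of_nonneg φ.nonneg]; exact φ.le_one
      have hL0 : (0 : ℝ) ≤ L := L.2
      rcases le_total 1 ‖h‖ with hh | hh
      · rw [min_eq_left hh]; linarith
      · rw [min_eq_right hh]; nlinarith [norm_nonneg h]
    calc ‖κ h * φ h‖ = |κ h| * ‖φ h‖ := by rw [norm_mul, Real.norm_eq_abs]
      _ ≤ |κ h| * ((1 + L) * min 1 ‖h‖) := by gcongr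
      _ = _ := by ring
  have hsupp : Metric.ball p 1 ⊆ Function.support fun h => κ h * φ h := fun h hb =>
    (mul_pos (hpos h hb) (φ.pos_of_mem_ball hb)).ne'
  have := (integral_pos_iff_support_of_nonneg hnn hint).2
    ((Metric.measure_ball_pos volume p one_pos).trans_le (measure_mono hsupp))
  exact this.ne' h0

theorem laplaceKernel_smul {s r : ℝ} (hr : 0 < r) (h : E) :
    laplaceKernel s (r • h) = r ^ (-((finrank ℝ E : ℝ) + s)) * laplaceKernel s h := by
  unfold laplaceKernel
  rw [norm_smul, Real.norm_eq_abs, abs_of_pos hr, Real.mul_rpow hr.le (norm_nonneg _)]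

theorem laplaceKernel_comp_linearIsometryEquiv (s : ℝ) (R : E ≃ₗᵢ[ℝ] E) :
    laplaceKernel s ∘ R = (laplaceKernel s : E → ℝ) := by
  ext h; simp [laplaceKernel]

theorem rieszKernel_smul {α r : ℝ} (hr : 0 < r) (e h : E) :
    rieszKernel α e (r • h) = r ^ (-((finrank ℝ E : ℝ) + α)) * rieszKernel α e h := by
  unfold rieszKernel
  rw [norm_smul, Real.norm_eq_abs, abs_of_pos hr, Real.mul_rpow hr.le (norm_nonneg _),
    real_inner_smul_left, mul_inv]
  field_simp

theorem rieszKernel_comp_linearIsometryEquiv (α : ℝ) (R : E ≃ₗᵢ[ℝ] E) (e : E) :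
    rieszKernel α (R e) ∘ R = rieszKernel α e := by
  ext h; simp [rieszKernel]

variable [Nontrivial E]

theorem symbol_rieszKernel_map (α : ℝ) (R : E ≃ₗᵢ[ℝ] E) (e ξ : E) :
    symbol (rieszKernel α (R e)) (R ξ) = symbol (rieszKernel α e) ξ := by
  rw [← symbol_comp_linearIsometryEquiv, rieszKernel_comp_linearIsometryEquiv]

theorem symbol_rieszKernel_add {α : ℝ} (hα₀ : 0 < α) (hα₁ : α < 1) (e e' ξ : E) :
    symbol (rieszKernel α (e + e')) ξ =
      symbol (rieszKernel α e) ξ + symbol (rieszKernel α e') ξ := by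
  unfold symbol
  rw [← integral_add ((isDifferenceKernel_rieszKernel hα₀ hα₁ e).integrable_symbol ξ)
    ((isDifferenceKernel_rieszKernel hα₀ hα₁ e').integrable_symbol ξ)]
  congr 1; ext h
  simp only [rieszKernel, inner_add_right]
  push_cast; ring

theorem symbol_rieszKernel_smul (α c : ℝ) (e ξ : E) :
    symbol (rieszKernel α (c • e)) ξ = c * symbol (rieszKernel α e) ξ := by
  unfold symbol
  rw [← integral_const_mul]
  congr 1; ext h
  simp only [rieszKernel, inner_smul_right]
  push_cast; ring

/-- Directions orthogonal to the frequency do not contribute: reflecting them preserves the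
frequency and changes the sign of the symbol. -/
theorem symbol_rieszKernel_of_inner_eq_zero (α : ℝ) {e ξ : E} (h : inner ℝ ξ e = 0) :
    symbol (rieszKernel α e) ξ = 0 := by
  have h1 := symbol_rieszKernel_map α (ℝ ∙ ξ).reflection e ξ
  rw [Submodule.reflection_mem_subspace_orthogonalComplement_eq_neg
      (Submodule.mem_orthogonal_singleton_iff_inner_right.2 h),
    Submodule.reflection_mem_subspace_eq_self (Submodule.mem_span_singleton_self ξ),
    ← neg_one_smul ℝ e, symbol_rieszKernel_smul] at h1
  push_cast at h1
  linear_combination (-1 / 2 : ℂ) * h1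

theorem symbol_rieszKernel_of_norm_eq_one {α : ℝ} (hα₀ : 0 < α) (hα₁ : α < 1) (e : E) {ξ ξ₀ : E}
    (hξ : ‖ξ‖ = 1) (hξ₀ : ‖ξ₀‖ = 1) :
    symbol (rieszKernel α e) ξ = (inner ℝ ξ e : ℝ) * symbol (rieszKernel α ξ₀) ξ₀ := by
  have h1 : symbol (rieszKernel α ξ) ξ = symbol (rieszKernel α ξ₀) ξ₀ := by
    have h2 := symbol_rieszKernel_map α (ℝ ∙ (ξ₀ - ξ))ᗮ.reflection ξ₀ ξ₀
    rwa [Submodule.reflection_sub (by rw [hξ, hξ₀])] at h2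
  have h3 : inner ℝ ξ (e - (inner ℝ ξ e : ℝ) • ξ) = 0 := by
    rw [inner_sub_right, real_inner_smul_right, real_inner_self_eq_norm_sq, hξ]; ring
  have h4 : e = (inner ℝ ξ e : ℝ) • ξ + (e - (inner ℝ ξ e : ℝ) • ξ) := by abel
  conv_lhs => rw [h4]
  rw [symbol_rieszKernel_add hα₀ hα₁, symbol_rieszKernel_smul,
    symbol_rieszKernel_of_inner_eq_zero α h3, add_zero, h1]

/-- The symbol of the Riesz kernel is a multiple of `‖ξ‖ ^ (α - 1) ⟪ξ, e⟫`. -/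
theorem symbol_rieszKernel_eq {α : ℝ} (hα₀ : 0 < α) (hα₁ : α < 1) (e ξ : E) {ξ₀ : E}
    (hξ₀ : ‖ξ₀‖ = 1) :
    symbol (rieszKernel α e) ξ =
      ((‖ξ‖ ^ (α - 1) * inner ℝ ξ e : ℝ) : ℂ) * symbol (rieszKernel α ξ₀) ξ₀ := by
  rcases eq_or_ne ξ 0 with rfl | hξ
  · simp [symbol]
  have h0 : 0 < ‖ξ‖ := norm_pos_iff.2 hξ
  have h1 : ξ = ‖ξ‖ • (‖ξ‖⁻¹ • ξ) := by rw [smul_smul, mul_inv_cancel₀ h0.ne', one_smul]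
  have h2 : ‖‖ξ‖⁻¹ • ξ‖ = 1 := norm_smul_inv_norm (𝕜 := ℝ) hξ
  conv_lhs => rw [h1]
  rw [symbol_smul_of_homogeneous (fun r hr h => rieszKernel_smul hr e h) h0,
    symbol_rieszKernel_of_norm_eq_one hα₀ hα₁ e h2 hξ₀,
    real_inner_smul_left, Real.rpow_sub_one h0.ne']
  push_cast
  ring

/-- The symbol of the Laplace kernel is a multiple of `‖ξ‖ ^ s`. -/
theorem symbol_laplaceKernel_eq (s : ℝ) (ξ : E) {ξ₀ : E} (hξ₀ : ‖ξ₀‖ = 1) (hs : s ≠ 0) :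
    symbol (laplaceKernel s) ξ = ((‖ξ‖ ^ s : ℝ) : ℂ) * symbol (laplaceKernel s) ξ₀ := by
  rcases eq_or_ne ξ 0 with rfl | hξ
  · simp [symbol, Real.zero_rpow hs]
  have h0 : 0 < ‖ξ‖ := norm_pos_iff.2 hξ
  have h1 : ‖ξ‖ • ((ℝ ∙ (ξ₀ - ‖ξ‖⁻¹ • ξ))ᗮ.reflection ξ₀) = ξ := by
    rw [Submodule.reflection_sub]
    · rw [smul_smul, mul_inv_cancel₀ h0.ne', one_smul]
    · rw [hξ₀]; exact (norm_smul_inv_norm (𝕜 := ℝ) hξ).symm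
  conv_lhs => rw [← h1]
  rw [symbol_smul_of_homogeneous (fun r hr h => laplaceKernel_smul hr h) h0,
    ← symbol_comp_linearIsometryEquiv, laplaceKernel_comp_linearIsometryEquiv]

theorem exists_symbol_mul_symbol {α : ℝ} (hα₀ : 0 < α) (hα₁ : α < 1) :
    ∃ C : ℝ, C ≠ 0 ∧ ∀ e ξ : E,
      symbol (laplaceKernel (1 - α)) ξ * symbol (rieszKernel α e) ξ =
        C * (2 * Real.pi * Complex.I * (inner ℝ ξ e : ℝ)) := by
  obtain ⟨ξ₀, hξ₀⟩ := exists_norm_eq E zero_le_one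
  set S := symbol (rieszKernel α ξ₀) ξ₀ with hS
  set P := symbol (laplaceKernel (1 - α) : E → ℝ) ξ₀ with hP
  have hpi : (2 * Real.pi * Complex.I : ℂ) ≠ 0 := Complex.two_pi_I_ne_zero
  have hball : ∀ h ∈ Metric.ball ((2 : ℝ) • ξ₀) 1, 0 < inner ℝ h ξ₀ ∧ 0 < ‖h‖ := fun h hh => by
    rw [Metric.mem_ball, dist_eq_norm] at hh
    have h1 : inner ℝ h ξ₀ = 2 + inner ℝ (h - (2 : ℝ) • ξ₀) ξ₀ := by
      rw [inner_sub_left, real_inner_smul_left, real_inner_self_eq_norm_sq, hξ₀]; ring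
    have h2 := (abs_le.1 (abs_real_inner_le_norm (h - (2 : ℝ) • ξ₀) ξ₀)).1
    rw [hξ₀, mul_one] at h2
    have h3 : 0 < inner ℝ h ξ₀ := by linarith
    exact ⟨h3, norm_pos_iff.2 fun h0 => by simp [h0] at h3⟩
  have hnorm : 1 ≤ ‖(2 : ℝ) • ξ₀‖ := by rw [norm_smul, hξ₀]; norm_num
  have hS0 : S ≠ 0 := by
    obtain ⟨ξ, hξ⟩ := (isDifferenceKernel_rieszKernel hα₀ hα₁ ξ₀).exists_symbol_ne_zero hnorm
      fun h hh => by
        obtain ⟨h1, h2⟩ := hball h hh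
        unfold rieszKernel; positivity
    rw [symbol_rieszKernel_eq hα₀ hα₁ ξ₀ ξ hξ₀] at hξ
    exact right_ne_zero_of_mul hξ
  have hP0 : P ≠ 0 := by
    obtain ⟨ξ, hξ⟩ := (isDifferenceKernel_laplaceKernel (E := E) (s := 1 - α) (by linarith)
      (by linarith)).exists_symbol_ne_zero hnorm
      fun h hh => by
        obtain ⟨h1, h2⟩ := hball h hh
        unfold laplaceKernel; positivity
    rw [symbol_laplaceKernel_eq (1 - α) ξ hξ₀ (by linarith)] at hξ
    exact right_ne_zero_of_mul hξ
  -- `S` is imaginary since the Riesz kernel is odd, `P` is real since the Laplace kernel is even.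
  have hSc : starRingEnd ℂ S = -S := by
    have h1 := symbol_rieszKernel_eq hα₀ hα₁ ξ₀ (-ξ₀) hξ₀
    rw [← conj_symbol, norm_neg, hξ₀, inner_neg_left, real_inner_self_eq_norm_sq, hξ₀] at h1
    simpa using h1
  have hPc : starRingEnd ℂ P = P := by
    have h1 := symbol_laplaceKernel_eq (1 - α) (-ξ₀) hξ₀ (by linarith)
    rw [← conj_symbol, norm_neg, hξ₀] at h1
    simpa using h1
  have hreal : starRingEnd ℂ (P * S / (2 * Real.pi * Complex.I)) =
      P * S / (2 * Real.pi * Complex.I) := by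
    simp only [map_div₀, map_mul, hSc, hPc, Complex.conj_ofReal, Complex.conj_I, map_ofNat]
    rw [mul_neg, mul_neg, neg_div_neg_eq]
  obtain ⟨C, hC⟩ := Complex.conj_eq_iff_real.1 hreal
  refine ⟨C, fun h0 => ?_, fun e ξ => ?_⟩
  · rw [h0, Complex.ofReal_zero, div_eq_zero_iff] at hC
    exact hC.elim (mul_ne_zero hP0 hS0) hpi
  · rw [symbol_rieszKernel_eq hα₀ hα₁ e ξ hξ₀, symbol_laplaceKernel_eq (1 - α) ξ hξ₀ (by linarith),
      ← hC]
    rcases eq_or_ne ξ 0 with rfl | hξ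
    · simp
    have h1 : ‖ξ‖ ^ (1 - α) * ‖ξ‖ ^ (α - 1) = 1 := by
      rw [← Real.rpow_add (norm_pos_iff.2 hξ)]; simp
    have h2 : ((‖ξ‖ ^ (1 - α) : ℝ) : ℂ) * ((‖ξ‖ ^ (α - 1) : ℝ) : ℂ) = 1 := by
      rw [← Complex.ofReal_mul, h1, Complex.ofReal_one]
    rw [Complex.ofReal_mul, ← hS, ← hP]
    field_simp
    linear_combination ((inner ℝ ξ e : ℝ) : ℂ) * h2

/-- Up to a nonzero factor, the fractional Laplacian of order `(1 - α) / 2` turns the Riesz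
fractional gradient of order `α` into the gradient. -/
theorem exists_diffOp_laplaceKernel_diffOp_rieszKernel {α : ℝ} (hα₀ : 0 < α) (hα₁ : α < 1) :
    ∃ C : ℝ, C ≠ 0 ∧ ∀ φ : E → ℝ, ContDiff ℝ ∞ φ → HasCompactSupport φ → ∀ e x : E,
      diffOp (laplaceKernel (1 - α)) (diffOp (rieszKernel α e) φ) x = C * fderiv ℝ φ x e := by
  obtain ⟨C, hC0, hC⟩ := exists_symbol_mul_symbol (E := E) hα₀ hα₁
  refine ⟨C, hC0, fun φ hφ hc e x => ?_⟩
  obtain ⟨a, hac, hai, hfa, hda⟩ := exists_fourier_amplitude hφ hc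
  have hρ := isDifferenceKernel_laplaceKernel (E := E) (s := 1 - α) (by linarith) (by linarith)
  have hκ := isDifferenceKernel_rieszKernel hα₀ hα₁ e
  have h1 : (fun y => ((diffOp (rieszKernel α e) φ y : ℝ) : ℂ)) =
      𝓕⁻ (fun ξ => symbol (rieszKernel α e) ξ * a ξ) := by
    ext y
    rw [ofReal_diffOp, hfa]
    exact hκ.diffOp_fourierInv hac.aestronglyMeasurable (integrable_one_add_norm_mul hai) y
  apply Complex.ofReal_injective
  rw [ofReal_diffOp, h1, hρ.diffOp_fourierInv
    (a := fun ξ => symbol (rieszKernel α e) ξ * a ξ)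
    (hκ.stronglyMeasurable_symbol.aestronglyMeasurable.mul hac.aestronglyMeasurable)
    (integrable_one_add_norm_mul (hκ.integrable_symbol_mul hac.aestronglyMeasurable hai)),
    Complex.ofReal_mul, hda, Real.fourierInv_eq, Real.fourierInv_eq, ← integral_const_mul]
  congr 1; ext ξ
  rw [← mul_assoc, hC, Circle.smul_def, Circle.smul_def, smul_eq_mul, smul_eq_mul]
  ring

end Composition

/-! ### Differences in `L¹` and symmetry of the fractional Laplacian -/

section Modulus

variable {E : Type*} [NormedAddCommGroup E] [InnerProductSpace ℝ E] [FiniteDimensional ℝ E]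
  [MeasurableSpace E] [BorelSpace E]

/-- `f` has differences bounded in `L¹` by `B * min 1 ‖h‖`; for integrable `f`, this holds
for some `B` precisely if `f` has bounded variation. -/
structure HasL1Modulus (f : E → ℝ) (B : ℝ) : Prop where
  measurable : Measurable f
  integrable : ∀ h, Integrable (fun x => f (x + h) - f x) volume
  integral_le : ∀ h, ∫ x, |f (x + h) - f x| ≤ B * min 1 ‖h‖

theorem integral_abs_le_mul_closedBall {g : E → ℝ} {M R : ℝ} (hM : ∀ x, |g x| ≤ M)
    (hz : ∀ x, R < ‖x‖ → g x = 0) :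
    ∫ x, |g x| ≤ M * volume.real (Metric.closedBall (0 : E) R) := by
  rw [← setIntegral_eq_integral_of_forall_compl_eq_zero (s := Metric.closedBall (0 : E) R)
    (fun x hx => by rw [hz x (by simpa using hx), abs_zero])]
  refine (Real.le_norm_self _).trans (norm_setIntegral_le_of_norm_le_const
    (measure_closedBall_lt_top) fun x _ => ?_)
  rw [Real.norm_eq_abs, abs_abs]
  exact hM x

theorem integral_abs_comp_add_right_sub_le {f : E → ℝ} (hf : Integrable f volume) (h : E) :
    ∫ x, |f (x + h) - f x| ≤ 2 * ∫ x, |f x| := by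
  calc ∫ x, |f (x + h) - f x| ≤ ∫ x, (|f (x + h)| + |f x|) :=
        integral_mono ((hf.comp_add_right h).sub hf).abs ((hf.comp_add_right h).abs.add hf.abs)
          fun x => abs_sub _ _
    _ = _ := by
        rw [integral_add (hf.comp_add_right h).abs hf.abs,
          integral_add_right_eq_self (fun x => |f x|) h]
        ring

/-- The `L¹` modulus of a Lipschitz function of compact support. -/
theorem integral_abs_sub_le {f : E → ℝ} (hf : Integrable f volume) {L R : ℝ} (hL0 : 0 ≤ L)
    (hL : ∀ x h, |f (x + h) - f x| ≤ L * ‖h‖) (hR : ∀ x, R < ‖x‖ → f x = 0) (h : E) :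
    ∫ x, |f (x + h) - f x| ≤
      (2 * (∫ x, |f x|) + L * volume.real (Metric.closedBall (0 : E) (R + 1))) * min 1 ‖h‖ := by
  have h1 : 0 ≤ ∫ x, |f x| := integral_nonneg fun x => abs_nonneg _
  have h2 : 0 ≤ volume.real (Metric.closedBall (0 : E) (R + 1)) := measureReal_nonneg
  rcases le_total 1 ‖h‖ with hh | hh
  · rw [min_eq_left hh]
    have := integral_abs_comp_add_right_sub_le hf h
    nlinarith [mul_nonneg hL0 h2]
  · rw [min_eq_right hh]
    have := integral_abs_le_mul_closedBall (R := R + 1) (fun x => hL x h) fun x hx => by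
      rw [hR x (by linarith), hR (x + h) ?_, sub_zero]
      have := norm_sub_le (x + h) h
      rw [add_sub_cancel_right] at this
      linarith
    nlinarith [mul_nonneg h1 (norm_nonneg h)]

/-- Iterated differences of a test function are bounded in `L¹` by a multiple of
`min 1 ‖h‖ * min 1 ‖k‖`. -/
theorem exists_hasL1Modulus {φ : E → ℝ} (hφ : ContDiff ℝ ∞ φ) (hc : HasCompactSupport φ) :
    ∃ B, HasL1Modulus φ B ∧ ∀ h, HasL1Modulus (fun x => φ (x + h) - φ x) (B * min 1 ‖h‖) := by
  obtain ⟨L, hL⟩ := hφ.lipschitzWith_of_hasCompactSupport hc (by simp)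
  obtain ⟨L', hL'⟩ := (hφ.fderiv_right (m := ∞) (by simp)).lipschitzWith_of_hasCompactSupport
    (hc.fderiv ℝ) (by simp)
  obtain ⟨R, hR⟩ := hc.isCompact.isBounded.subset_closedBall 0
  have hR' : ∀ x, R < ‖x‖ → φ x = 0 := fun x hx => by
    by_contra hne
    have := hR (subset_tsupport φ hne)
    rw [mem_closedBall_zero_iff] at this
    linarith
  have hint : Integrable φ volume := hφ.continuous.integrable_of_hasCompactSupport hc
  have hLip : ∀ x h, |φ (x + h) - φ x| ≤ L * ‖h‖ := fun x h => by
    have := hL.dist_le_mul (x + h) x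
    rwa [dist_eq_norm, dist_eq_norm, add_sub_cancel_left, Real.norm_eq_abs] at this
  have hdiff : Differentiable ℝ φ := hφ.differentiable (by simp)
  have hLip2 : ∀ h x k, |(φ (x + k + h) - φ (x + k)) - (φ (x + h) - φ x)| ≤ L' * ‖h‖ * ‖k‖ := by
    intro h x k
    have hd : ∀ y, HasFDerivAt (fun y => φ (y + h) - φ y)
        (fderiv ℝ φ (y + h) - fderiv ℝ φ y) y := fun y =>
      ((hasFDerivAt_comp_add_right h).2 (hdiff (y + h)).hasFDerivAt).sub (hdiff y).hasFDerivAt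
    have := Convex.norm_image_sub_le_of_norm_hasFDerivWithin_le (s := univ) (C := L' * ‖h‖)
      (fun y _ => (hd y).hasFDerivWithinAt) (fun y _ => ?_) convex_univ (mem_univ x)
      (mem_univ (x + k))
    · rwa [add_sub_cancel_left, Real.norm_eq_abs] at this
    · have := hL'.dist_le_mul (y + h) y
      rwa [dist_eq_norm, dist_eq_norm, add_sub_cancel_left] at this
  set V := volume.real (Metric.closedBall (0 : E) (R + 1 + 1)) with hV
  set B₁ := 2 * (∫ x, |φ x|) + L * volume.real (Metric.closedBall (0 : E) (R + 1)) with hB₁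
  have hB₁0 : 0 ≤ B₁ := by
    have h1 : 0 ≤ ∫ x, |φ x| := integral_nonneg fun x => abs_nonneg _
    positivity
  have hV0 : 0 ≤ V := measureReal_nonneg
  have hmod : ∀ h, ∫ x, |φ (x + h) - φ x| ≤ B₁ * min 1 ‖h‖ :=
    integral_abs_sub_le hint L.2 hLip hR'
  have hI : ∀ h, Integrable (fun x => φ (x + h) - φ x) volume := fun h =>
    (hint.comp_add_right h).sub hint
  have hL'0 : (0 : ℝ) ≤ L' := L'.2
  refine ⟨2 * B₁ + L' * V, ⟨hφ.continuous.measurable, hI, fun h => (hmod h).trans ?_⟩, fun h =>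
    ⟨?_, fun k => ((hI h).comp_add_right k).sub (hI h), fun k => ?_⟩⟩
  · gcongr
    nlinarith [mul_nonneg hL'0 hV0]
  · exact (by have := hφ.continuous; fun_prop : Continuous fun x => φ (x + h) - φ x).measurable
  -- For large `h` or `k` the iterated difference is estimated as a difference of the other single
  -- difference; if both are small, by the second derivative on a ball containing its support.
  · have hLV : 0 ≤ L' * V * ‖h‖ * ‖k‖ := by positivity
    have hBhk : 0 ≤ B₁ * ‖h‖ * ‖k‖ := by positivity
    rcases le_total 1 ‖h‖ with hh | hh
    · rw [min_eq_left hh]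
      have h1 : ∫ x, |(φ (x + k + h) - φ (x + k)) - (φ (x + h) - φ x)| =
          ∫ x, |(φ ((x + h) + k) - φ (x + h)) - (φ (x + k) - φ x)| := by
        congr 1; ext x
        rw [add_right_comm]; congr 1; ring
      rw [h1]
      have h2 := integral_abs_comp_add_right_sub_le (hI k) h
      have h3 := hmod k
      have h4 : 0 ≤ L' * V * min 1 ‖k‖ := by positivity
      nlinarith
    · rcases le_total 1 ‖k‖ with hk | hk
      · rw [min_eq_right hh, min_eq_left hk]
        have h2 := integral_abs_comp_add_right_sub_le (hI h) k
        have h3 := hmod h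
        rw [min_eq_right hh] at h3
        have h4 : 0 ≤ L' * V * ‖h‖ := by positivity
        nlinarith
      · rw [min_eq_right hh, min_eq_right hk]
        have := integral_abs_le_mul_closedBall (R := R + 1 + 1) (fun x => hLip2 h x k) fun x hx => by
          have hxk := norm_sub_le (x + k) k
          have hxh := norm_sub_le (x + h) h
          have hxkh := norm_sub_le (x + k + h) h
          rw [add_sub_cancel_right] at hxk hxh hxkh
          rw [hR' x (by linarith), hR' (x + h) (by linarith), hR' (x + k) (by linarith),
            hR' (x + k + h) (by linarith), sub_zero, sub_zero]
        nlinarith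

theorem HasL1Modulus.integrable_prod {f : E → ℝ} {B : ℝ} (hf : HasL1Modulus f B) {κ : E → ℝ}
    (hκ : IsDifferenceKernel κ) :
    Integrable (fun p : E × E => κ p.2 * (f (p.1 + p.2) - f p.1)) (volume.prod volume) := by
  have hm : Measurable fun p : E × E => κ p.2 * (f (p.1 + p.2) - f p.1) :=
    (hκ.measurable.comp measurable_snd).mul
      ((hf.measurable.comp (measurable_fst.add measurable_snd)).sub
        (hf.measurable.comp measurable_fst))
  rw [integrable_prod_iff' hm.aestronglyMeasurable]
  refine ⟨.of_forall fun h => (hf.integrable h).const_mul (κ h), ?_⟩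
  refine (hκ.integrable.const_mul B).mono' (hm.norm.stronglyMeasurable.integral_prod_left'
    |>.aestronglyMeasurable) (.of_forall fun h => ?_)
  rw [Real.norm_eq_abs, abs_of_nonneg (integral_nonneg fun x => norm_nonneg _)]
  simp only [norm_mul, Real.norm_eq_abs]
  rw [integral_const_mul]
  calc |κ h| * ∫ x, |f (x + h) - f x| ≤ |κ h| * (B * min 1 ‖h‖) := by
        gcongr; exact hf.integral_le h
    _ = _ := by ring

theorem measurable_diffOp {f : E → ℝ} (hf : Measurable f) {κ : E → ℝ}
    (hκ : Measurable κ) : Measurable (diffOp κ f) := by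
  have hm : Measurable fun p : E × E => κ p.2 • (f (p.1 + p.2) - f p.1) :=
    (hκ.comp measurable_snd).smul
      ((hf.comp (measurable_fst.add measurable_snd)).sub (hf.comp measurable_fst))
  exact hm.stronglyMeasurable.integral_prod_right'.measurable

theorem HasL1Modulus.integrable_diffOp {f : E → ℝ} {B : ℝ} (hf : HasL1Modulus f B) {κ : E → ℝ}
    (hκ : IsDifferenceKernel κ) : Integrable (diffOp κ f) volume :=
  (hf.integrable_prod hκ).integral_prod_left

theorem HasL1Modulus.integral_abs_diffOp_le {f : E → ℝ} {B : ℝ} (hf : HasL1Modulus f B)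
    {κ : E → ℝ} (hκ : IsDifferenceKernel κ) :
    ∫ x, |diffOp κ f x| ≤ B * ∫ h, min 1 ‖h‖ * |κ h| := by
  have hp := hf.integrable_prod hκ
  calc ∫ x, |diffOp κ f x| ≤ ∫ x, ∫ h, ‖κ h * (f (x + h) - f x)‖ :=
        integral_mono (hf.integrable_diffOp hκ).abs hp.norm.integral_prod_left
          fun x => by
            rw [← Real.norm_eq_abs]
            exact norm_integral_le_integral_norm _
    _ = ∫ h, ∫ x, ‖κ h * (f (x + h) - f x)‖ := integral_integral_swap hp.norm
    _ ≤ ∫ h, B * (min 1 ‖h‖ * |κ h|) := by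
        refine integral_mono hp.norm.integral_prod_right (hκ.integrable.const_mul B) fun h => ?_
        simp only [norm_mul, Real.norm_eq_abs]
        rw [integral_const_mul]
        calc |κ h| * ∫ x, |f (x + h) - f x| ≤ |κ h| * (B * min 1 ‖h‖) := by
              gcongr; exact hf.integral_le h
          _ = _ := by ring
    _ = _ := integral_const_mul _ _

/-- Bounded Lipschitz functions can be integrated against a difference kernel pointwise. -/
theorem IsDifferenceKernel.integrable_mul_sub {κ : E → ℝ} (hκ : IsDifferenceKernel κ) {φ : E → ℝ}
    (hφ : ContDiff ℝ ∞ φ) (hc : HasCompactSupport φ) (x : E) :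
    Integrable (fun h => κ h * (φ (x + h) - φ x)) volume := by
  obtain ⟨L, hL⟩ := hφ.lipschitzWith_of_hasCompactSupport hc (by simp)
  obtain ⟨M, hM⟩ := hc.exists_bound_of_continuous hφ.continuous
  have hL0 : (0 : ℝ) ≤ L := L.2
  have hM0 : 0 ≤ M := (norm_nonneg _).trans (hM x)
  refine (hκ.integrable.const_mul (2 * M + L)).mono' ?_ (.of_forall fun h => ?_)
  · have := hφ.continuous
    exact (hκ.measurable.mul (by fun_prop : Continuous fun h => φ (x + h) - φ x).measurable)
      |>.aestronglyMeasurable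
  have h1 : ‖φ (x + h) - φ x‖ ≤ (2 * M + L) * min 1 ‖h‖ := by
    rcases le_total 1 ‖h‖ with hh | hh
    · rw [min_eq_left hh]
      linarith [norm_sub_le (φ (x + h)) (φ x), hM x, hM (x + h)]
    · rw [min_eq_right hh]
      have := hL.dist_le_mul (x + h) x
      rw [dist_eq_norm, dist_eq_norm, add_sub_cancel_left] at this
      nlinarith [norm_nonneg h]
  calc ‖κ h * (φ (x + h) - φ x)‖ = |κ h| * ‖φ (x + h) - φ x‖ := by rw [norm_mul, Real.norm_eq_abs]
    _ ≤ |κ h| * ((2 * M + L) * min 1 ‖h‖) := by gcongr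
    _ = _ := by ring

/-- The operator `diffOp κ` maps test functions to integrable functions of bounded variation, as it
commutes with taking differences. -/
theorem exists_hasL1Modulus_diffOp {φ : E → ℝ} (hφ : ContDiff ℝ ∞ φ) (hc : HasCompactSupport φ)
    {κ : E → ℝ} (hκ : IsDifferenceKernel κ) :
    Integrable (diffOp κ φ) volume ∧ ∃ B, HasL1Modulus (diffOp κ φ) B := by
  obtain ⟨B, hB, hB2⟩ := exists_hasL1Modulus hφ hc
  have hint := hB.integrable_diffOp hκ
  refine ⟨hint, B * ∫ h, min 1 ‖h‖ * |κ h|, measurable_diffOp hB.measurable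
    hκ.measurable, fun h => (hint.comp_add_right h).sub hint, fun h => ?_⟩
  have h1 : ∀ x, diffOp κ φ (x + h) - diffOp κ φ x = diffOp κ (fun x => φ (x + h) - φ x) x := by
    intro x
    unfold diffOp
    simp only [smul_eq_mul]
    rw [← integral_sub (hκ.integrable_mul_sub hφ hc _) (hκ.integrable_mul_sub hφ hc _)]
    congr 1; ext k
    rw [add_right_comm x k h]; ring
  simp only [h1]
  refine ((hB2 h).integral_abs_diffOp_le hκ).trans (le_of_eq (by ring))

/-- The operator `diffOp ρ` of an even kernel is symmetric. One factor is a bounded function with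
Lipschitz bounds almost everywhere, the other one an integrable function of bounded variation. -/
theorem IsDifferenceKernel.integral_diffOp_mul {ρ : E → ℝ} (hρ : IsDifferenceKernel ρ)
    (heven : ∀ h, ρ (-h) = ρ h) {v : E → ℝ} (hvm : Measurable v) {M L : ℝ}
    (hM : ∀ x, |v x| ≤ M) (hL : ∀ h, ∀ᵐ x, |v (x + h) - v x| ≤ L * ‖h‖) {ψ : E → ℝ} {B : ℝ}
    (hψ : Integrable ψ volume) (hψB : HasL1Modulus ψ B) :
    ∫ x, diffOp ρ v x * ψ x = ∫ x, v x * diffOp ρ ψ x := by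
  have hρm := hρ.measurable
  have hψm := hψB.measurable
  have hM0 : 0 ≤ M := (abs_nonneg _).trans (hM 0)
  have hvadd : Measurable fun p : E × E => v (p.1 + p.2) - v p.1 :=
    (hvm.comp (measurable_fst.add measurable_snd)).sub (hvm.comp measurable_fst)
  have hae : ∀ᵐ p : E × E ∂(volume.prod volume), |v (p.1 + p.2) - v p.1| ≤ L * ‖p.2‖ := by
    have hs : MeasurableSet {p : E × E | |v (p.1 + p.2) - v p.1| ≤ L * ‖p.2‖} :=
      measurableSet_le hvadd.abs (by fun_prop)
    rw [Measure.ae_prod_iff_ae_ae hs]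
    exact (Measure.ae_ae_comm (p := fun x h => |v (x + h) - v x| ≤ L * ‖h‖) hs).2
      (.of_forall hL)
  have h1 : Integrable (fun p : E × E => ρ p.2 * (v (p.1 + p.2) - v p.1) * ψ p.1)
      (volume.prod volume) := by
    refine ((hψ.abs.mul_prod hρ.integrable).const_mul (2 * M + |L|)).mono' ?_ ?_
    · exact (((hρm.comp measurable_snd).mul hvadd).mul (hψm.comp measurable_fst))
        |>.aestronglyMeasurable
    · filter_upwards [hae] with p hp
      have h2 : |v (p.1 + p.2) - v p.1| ≤ (2 * M + |L|) * min 1 ‖p.2‖ := by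
        rcases le_total 1 ‖p.2‖ with hh | hh
        · rw [min_eq_left hh]
          linarith [abs_sub (v (p.1 + p.2)) (v p.1), hM p.1, hM (p.1 + p.2), abs_nonneg L]
        · rw [min_eq_right hh]
          nlinarith [norm_nonneg p.2, le_abs_self L, abs_nonneg L]
      rw [Real.norm_eq_abs, abs_mul, abs_mul]
      calc |ρ p.2| * |v (p.1 + p.2) - v p.1| * |ψ p.1|
          ≤ |ρ p.2| * ((2 * M + |L|) * min 1 ‖p.2‖) * |ψ p.1| := by gcongr
        _ = _ := by ring
  have h2 : Integrable (fun p : E × E => v p.1 * (ρ p.2 * (ψ (p.1 + p.2) - ψ p.1)))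
      (volume.prod volume) := by
    refine (hψB.integrable_prod hρ).bdd_mul (c := M)
      (hvm.comp measurable_fst).aestronglyMeasurable (.of_forall fun p => hM p.1)
  have hvψ : Integrable (fun x => v x * ψ x) volume :=
    hψ.bdd_mul (c := M) hvm.aestronglyMeasurable (.of_forall hM)
  have hkey : ∀ h, ∫ x, (v (x + h) - v x) * ψ x = ∫ x, v x * (ψ (x + -h) - ψ x) := by
    intro h
    have h3 : Integrable (fun x => v (x + h) * ψ x) volume :=
      hψ.bdd_mul (c := M) (hvm.comp (measurable_add_const h)).aestronglyMeasurable
        (.of_forall fun x => hM _)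
    have h4 : Integrable (fun x => v x * ψ (x + -h)) volume :=
      (hψ.comp_add_right (-h)).bdd_mul (c := M) hvm.aestronglyMeasurable (.of_forall hM)
    simp only [sub_mul, mul_sub]
    rw [integral_sub h3 hvψ, integral_sub h4 hvψ,
      ← integral_add_right_eq_self (fun x => v x * ψ (x + -h)) h]
    simp
  calc ∫ x, diffOp ρ v x * ψ x = ∫ x, ∫ h, ρ h * (v (x + h) - v x) * ψ x := by
        congr 1; ext x
        rw [diffOp, ← integral_mul_const]
        rfl
    _ = ∫ h, ∫ x, ρ h * (v (x + h) - v x) * ψ x := integral_integral_swap h1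
    _ = ∫ h, ρ (-h) * ∫ x, v x * (ψ (x + -h) - ψ x) := by
        congr 1; ext h
        rw [heven, ← hkey, ← integral_const_mul]
        simp only [mul_assoc]
    _ = ∫ h, ρ h * ∫ x, v x * (ψ (x + h) - ψ x) :=
        integral_neg_eq_self (fun h => ρ h * ∫ x, v x * (ψ (x + h) - ψ x)) volume
    _ = ∫ h, ∫ x, v x * (ρ h * (ψ (x + h) - ψ x)) := by
        congr 1; ext h
        rw [← integral_const_mul]
        congr 1; ext x; ring
    _ = ∫ x, ∫ h, v x * (ρ h * (ψ (x + h) - ψ x)) := (integral_integral_swap h2).symm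
    _ = _ := by
        congr 1; ext x
        rw [integral_const_mul]
        rfl

end Modulus

/-! ### Bounded measurable representatives -/

section Representatives

theorem exists_measurable_bounded_ae_eq {X F : Type*} [MeasurableSpace X] {μ : Measure X}
    [NormedAddCommGroup F] [MeasurableSpace F] [BorelSpace F] {f : X → F} (hf : MemLp f ⊤ μ) :
    ∃ (f' : X → F) (M : ℝ), StronglyMeasurable f' ∧ 0 ≤ M ∧ (∀ x, ‖f' x‖ ≤ M) ∧ f =ᵐ[μ] f' := by
  set g := hf.aestronglyMeasurable.mk f with hg
  have hgm : StronglyMeasurable g := hf.aestronglyMeasurable.stronglyMeasurable_mk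
  set M := (eLpNormEssSup f μ).toReal with hM
  have hb : ∀ᵐ x ∂μ, ‖f x‖ ≤ M := by
    have htop : eLpNormEssSup f μ ≠ ⊤ := by
      have := hf.eLpNorm_lt_top
      rw [eLpNorm_exponent_top] at this
      exact this.ne
    filter_upwards [ae_le_eLpNormEssSup (f := f) (μ := μ)] with x hx
    rw [← toReal_enorm]
    exact ENNReal.toReal_mono htop hx
  refine ⟨{x | ‖g x‖ ≤ M}.indicator g, M, hgm.indicator
    (measurableSet_le hgm.norm.measurable measurable_const), ENNReal.toReal_nonneg, fun x => ?_, ?_⟩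
  · rw [indicator_apply]
    split_ifs with h
    · exact h
    · rw [norm_zero]; exact ENNReal.toReal_nonneg
  · filter_upwards [hb, hf.aestronglyMeasurable.ae_eq_mk] with x hx hx'
    rw [indicator_of_mem (by rwa [mem_ofPred_eq, hg, ← hx']), hg, ← hx']

end Representatives

/-! ### Functions with bounded weak gradient -/

section WeakGradients

variable {n : ℕ}

local notation "𝔼" => EuclideanSpace ℝ (Fin n)

theorem IsTestFunction.comp_sub {φ : 𝔼 → ℝ} (hφ : IsTestFunction φ) (a : 𝔼) :
    IsTestFunction fun x => φ (x - a) :=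
  ⟨hφ.1.comp (contDiff_id.sub contDiff_const),
    hφ.2.comp_homeomorph (Homeomorph.subRight a)⟩

theorem IsTestFunction.continuous_fderiv_apply {φ : 𝔼 → ℝ} (hφ : IsTestFunction φ) (e : 𝔼) :
    Continuous fun x => fderiv ℝ φ x e :=
  (hφ.1.continuous_fderiv (by simp)).clm_apply continuous_const

theorem IsTestFunction.hasCompactSupport_fderiv_apply {φ : 𝔼 → ℝ} (hφ : IsTestFunction φ)
    (e : 𝔼) : HasCompactSupport fun x => fderiv ℝ φ x e :=
  (hφ.2.fderiv ℝ).comp_left (g := fun A : 𝔼 →L[ℝ] ℝ => A e) rfl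

theorem IsTestFunction.continuous_gradient {φ : 𝔼 → ℝ} (hφ : IsTestFunction φ) :
    Continuous (gradient φ) :=
  (InnerProductSpace.toDual ℝ 𝔼).symm.continuous.comp (hφ.1.continuous_fderiv (by simp))

theorem IsTestFunction.hasCompactSupport_gradient {φ : 𝔼 → ℝ} (hφ : IsTestFunction φ) :
    HasCompactSupport (gradient φ) :=
  (hφ.2.fderiv ℝ).comp_left (map_zero (InnerProductSpace.toDual ℝ 𝔼).symm)

/-- The defining identity of the weak gradient in direction `e`. -/
theorem HasWeakGradient.integral_mul_inner {v : 𝔼 → ℝ} {g : 𝔼 → 𝔼} (h : HasWeakGradient v g)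
    {φ : 𝔼 → ℝ} (hφ : IsTestFunction φ) (e : 𝔼) :
    ∫ x, φ x * inner ℝ e (g x) = -∫ x, v x * fderiv ℝ φ x e := by
  have h1 : Integrable (fun x => φ x • g x) volume :=
    h.2.1.integrable_smul_left_of_hasCompactSupport hφ.1.continuous hφ.2
  have h2 : Integrable (fun x => v x • gradient φ x) volume :=
    h.1.integrable_smul_right_of_hasCompactSupport hφ.continuous_gradient
      hφ.hasCompactSupport_gradient
  have h3 := congrArg (inner ℝ e) (h.2.2 φ hφ)
  rw [inner_neg_right, ← integral_inner h1, ← integral_inner h2] at h3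
  simp only [inner_smul_right] at h3
  rw [h3]
  congr 2; ext x
  rw [real_inner_comm, inner_gradient_left]

/-- A function whose weak gradient is bounded by `G` satisfies the Lipschitz bound with constant
`G` almost everywhere, for each increment: the difference `v (x + h) - v x` equals
`∫₀¹ ⟪g (x + t h), h⟫ dt`, as one sees by testing with smooth functions. -/
theorem HasWeakGradient.ae_abs_sub_le {v : 𝔼 → ℝ} {g : 𝔼 → 𝔼} (h : HasWeakGradient v g)
    (hv : StronglyMeasurable v) {M G : ℝ} (hM : ∀ x, ‖v x‖ ≤ M) (hg : StronglyMeasurable g)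
    (hG : ∀ x, ‖g x‖ ≤ G) (a : 𝔼) : ∀ᵐ x, |v (x + a) - v x| ≤ G * ‖a‖ := by
  have hgm : Measurable fun p : 𝔼 × ℝ => inner ℝ a (g (p.1 + p.2 • a)) :=
    (measurable_const.inner (hg.measurable.comp (by fun_prop)))
  have hgb : ∀ x, ‖inner ℝ a (g x)‖ ≤ G * ‖a‖ := fun x => by
    rw [Real.norm_eq_abs, mul_comm]
    exact (abs_real_inner_le_norm a (g x)).trans (by gcongr; exact hG x)
  set H : 𝔼 → ℝ := fun x => ∫ t in Icc (0 : ℝ) 1, inner ℝ a (g (x + t • a)) with hH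
  have hHm : StronglyMeasurable H := hgm.stronglyMeasurable.integral_prod_right'
  have hHb : ∀ x, ‖H x‖ ≤ G * ‖a‖ := fun x => by
    have := norm_setIntegral_le_of_norm_le_const (μ := volume) (s := Icc (0 : ℝ) 1)
      (by simp) (fun t _ => hgb (x + t • a))
    simpa using this
  have hloc : ∀ {f : 𝔼 → ℝ} {C : ℝ}, StronglyMeasurable f → (∀ x, ‖f x‖ ≤ C) →
      LocallyIntegrable f volume := fun {f C} hf hC =>
    (memLp_top_of_bound hf.aestronglyMeasurable C (.of_forall hC)).locallyIntegrable (by simp)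
  have hva : StronglyMeasurable fun x => v (x + a) :=
    hv.comp_measurable (measurable_add_const a)
  have key : ∀ φ : 𝔼 → ℝ, ContDiff ℝ ∞ φ → HasCompactSupport φ →
      ∫ x, φ x • (v (x + a) - v x) = ∫ x, φ x • H x := by
    intro φ hφs hφc
    have hφ : IsTestFunction φ := ⟨hφs, hφc⟩
    have hφI : Integrable φ volume := hφs.continuous.integrable_of_hasCompactSupport hφc
    obtain ⟨L, hL⟩ := (hφ.hasCompactSupport_fderiv_apply a).exists_bound_of_continuous
      (hφ.continuous_fderiv_apply a)
    obtain ⟨R, hR⟩ := hφc.isCompact.isBounded.subset_closedBall 0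
    have hFTC : ∀ x, φ (x - a) - φ x = ∫ t in Icc (0 : ℝ) 1, -fderiv ℝ φ (x - t • a) a := by
      intro x
      rw [integral_Icc_eq_integral_Ioc, ← intervalIntegral.integral_of_le zero_le_one,
        intervalIntegral.integral_eq_sub_of_hasDerivAt (f := fun t : ℝ => φ (x - t • a))]
      · simp
      · intro t _
        have h1 : HasDerivAt (fun t : ℝ => x - t • a) (-a) t := by
          simpa using ((hasDerivAt_id t).smul_const a).const_sub x
        have h2 := (hφs.differentiable (by simp) (x - t • a)).hasFDerivAt.comp_hasDerivAt t h1
        rw [map_neg] at h2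
        exact h2
      · exact ((hφ.continuous_fderiv_apply a).comp (by fun_prop)).neg.intervalIntegrable _ _
    have hI1 : Integrable (fun p : 𝔼 × ℝ => v p.1 * -fderiv ℝ φ (p.1 - p.2 • a) a)
        (volume.prod (volume.restrict (Icc 0 1))) := by
      have hind : Integrable (fun p : 𝔼 × ℝ =>
          (Metric.closedBall (0 : 𝔼) (R + ‖a‖)).indicator (fun _ => M * L) p.1)
          (volume.prod (volume.restrict (Icc (0 : ℝ) 1))) := by
        refine Integrable.comp_fst (f := (Metric.closedBall (0 : 𝔼) (R + ‖a‖)).indicator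
          (fun _ => M * L)) ?_ _
        rw [integrable_indicator_iff Metric.isClosed_closedBall.measurableSet]
        exact integrableOn_const measure_closedBall_lt_top.ne
      refine hind.mono' ?_ ?_
      · exact ((hv.measurable.comp measurable_fst).mul
          ((hφ.continuous_fderiv_apply a).comp (by fun_prop)).neg.measurable).aestronglyMeasurable
      · have hmem : ∀ᵐ p : 𝔼 × ℝ ∂(volume.prod (volume.restrict (Icc (0 : ℝ) 1))),
            p.2 ∈ Icc (0 : ℝ) 1 :=
          Measure.quasiMeasurePreserving_snd.ae (ae_restrict_mem measurableSet_Icc)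
        filter_upwards [hmem] with p hp
        by_cases hball : p.1 ∈ Metric.closedBall (0 : 𝔼) (R + ‖a‖)
        · rw [indicator_of_mem hball, norm_mul, norm_neg]
          have := hM p.1
          have := hL (p.1 - p.2 • a)
          gcongr
          exact (norm_nonneg _).trans (hM p.1)
        · rw [indicator_of_notMem hball]
          have hz : fderiv ℝ φ (p.1 - p.2 • a) a = 0 := by
            by_contra hne
            have h1 : p.1 - p.2 • a ∈ tsupport φ := by
              refine support_fderiv_subset ℝ (fun h0 => hne ?_)
              rw [h0]; rfl
            have h2 := hR h1
            rw [mem_closedBall_zero_iff] at h2 hball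
            have h3 : ‖p.2 • a‖ ≤ ‖a‖ := by
              rw [norm_smul, Real.norm_eq_abs, abs_of_nonneg hp.1]
              nlinarith [norm_nonneg a, hp.2]
            have h4 := norm_add_le (p.1 - p.2 • a) (p.2 • a)
            rw [sub_add_cancel] at h4
            exact hball (by linarith)
          simp [hz]
    have hI2 : Integrable (fun p : 𝔼 × ℝ => φ p.1 * inner ℝ a (g (p.1 + p.2 • a)))
        (volume.prod (volume.restrict (Icc 0 1))) :=
      (hφI.comp_fst _).mul_bdd (c := G * ‖a‖) hgm.aestronglyMeasurable
        (.of_forall fun p => hgb _)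
    have hI3 : Integrable (fun x => φ x * v (x + a)) volume :=
      hφI.mul_bdd (c := M) hva.aestronglyMeasurable (.of_forall fun x => hM _)
    have hI4 : Integrable (fun x => φ x * v x) volume :=
      hφI.mul_bdd (c := M) hv.aestronglyMeasurable (.of_forall fun x => hM _)
    have hI5 : Integrable (fun x => φ (x - a) * v x) volume :=
      (hφI.comp_sub_right a).mul_bdd (c := M) hv.aestronglyMeasurable (.of_forall fun x => hM _)
    calc ∫ x, φ x • (v (x + a) - v x)
        = ∫ x, v x * (φ (x - a) - φ x) := by
          simp only [smul_eq_mul, mul_sub, sub_mul, mul_comm (v _)]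
          rw [integral_sub hI3 hI4, integral_sub hI5 hI4,
            ← integral_add_right_eq_self (fun x => φ (x - a) * v x) a]
          simp
      _ = ∫ x, ∫ t in Icc (0 : ℝ) 1, v x * -fderiv ℝ φ (x - t • a) a := by
          congr 1; ext x
          rw [hFTC, integral_const_mul]
      _ = ∫ t in Icc (0 : ℝ) 1, ∫ x, v x * -fderiv ℝ φ (x - t • a) a :=
          integral_integral_swap hI1
      _ = ∫ t in Icc (0 : ℝ) 1, ∫ x, φ x * inner ℝ a (g (x + t • a)) := by
          congr 1; ext t
          have h1 := h.integral_mul_inner (hφ.comp_sub (t • a)) a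
          simp only [fderiv_comp_sub] at h1
          rw [← integral_add_right_eq_self _ (t • a)] at h1
          simp only [add_sub_cancel_right] at h1
          rw [h1, ← integral_neg]
          simp
      _ = ∫ x, ∫ t in Icc (0 : ℝ) 1, φ x * inner ℝ a (g (x + t • a)) :=
          (integral_integral_swap hI2).symm
      _ = ∫ x, φ x • H x := by
          congr 1; ext x
          rw [integral_const_mul]; rfl
  have hae := ae_eq_of_integral_contDiff_smul_eq (μ := volume)
    ((hloc hva fun x => hM _).sub (hloc hv hM)) (hloc hHm hHb) key
  filter_upwards [hae] with x hx
  have h1 := hHb x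
  rw [← hx] at h1
  exact h1

end WeakGradients

/-! ### The Riesz fractional gradient of a test function -/

section RieszGradient

variable {n : ℕ}

local notation "𝔼" => EuclideanSpace ℝ (Fin n)

theorem rieszGradientConst_pos {α : ℝ} (hα₀ : 0 < α) (hα₁ : α < 1) :
    0 < rieszGradientConst n α := by
  unfold rieszGradientConst
  have h1 : 0 < Real.Gamma (((n : ℝ) + α + 1) / 2) := Real.Gamma_pos_of_pos (by positivity)
  have h2 : 0 < Real.Gamma ((1 - α) / 2) := Real.Gamma_pos_of_pos (by linarith)
  have := Real.pi_pos
  positivity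

theorem integrable_rieszGradient_integrand [Nontrivial 𝔼] {α : ℝ} (hα₀ : 0 < α) (hα₁ : α < 1)
    {φ : 𝔼 → ℝ} (hφ : IsTestFunction φ) (x : 𝔼) :
    Integrable (fun h : 𝔼 => ((φ (x + h) - φ x) / ‖h‖ ^ ((n : ℝ) + α)) • (‖h‖⁻¹ • h)) volume := by
  have h1 := (isDifferenceKernel_laplaceKernel (E := 𝔼) hα₀ hα₁).integrable_mul_sub hφ.1 hφ.2 x
  refine h1.mono ?_ (.of_forall fun h => ?_)
  · have := hφ.1.continuous
    have hm : Measurable fun h : 𝔼 => φ (x + h) - φ x :=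
      (by fun_prop : Continuous fun h : 𝔼 => φ (x + h) - φ x).measurable
    exact (by fun_prop :
      Measurable fun h : 𝔼 => ((φ (x + h) - φ x) / ‖h‖ ^ ((n : ℝ) + α)) • (‖h‖⁻¹ • h))
      |>.aestronglyMeasurable
  · rw [laplaceKernel, finrank_euclideanSpace_fin, norm_smul, norm_smul, norm_div, norm_mul,
      Real.rpow_neg (norm_nonneg _), norm_inv, norm_inv, norm_norm, div_eq_inv_mul]
    refine mul_le_of_le_one_right (by positivity) ?_
    rcases eq_or_ne h 0 with rfl | hh
    · simp
    · rw [inv_mul_cancel₀ (norm_ne_zero_iff.2 hh)]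

theorem rieszGradient_eq_integral (α : ℝ) (φ : 𝔼 → ℝ) (x : 𝔼) :
    rieszGradient α φ x = rieszGradientConst n α •
      ∫ h : 𝔼, ((φ (x + h) - φ x) / ‖h‖ ^ ((n : ℝ) + α)) • (‖h‖⁻¹ • h) := by
  unfold rieszGradient
  rw [← integral_add_left_eq_self _ x]
  simp

/-- The components of the Riesz fractional gradient are difference operators. -/
theorem inner_rieszGradient [Nontrivial 𝔼] {α : ℝ} (hα₀ : 0 < α) (hα₁ : α < 1) {φ : 𝔼 → ℝ}
    (hφ : IsTestFunction φ) (e x : 𝔼) :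
    inner ℝ e (rieszGradient α φ x) =
      rieszGradientConst n α * diffOp (rieszKernel α e) φ x := by
  rw [rieszGradient_eq_integral, inner_smul_right,
    ← integral_inner (integrable_rieszGradient_integrand hα₀ hα₁ hφ x)]
  congr 1
  unfold diffOp
  congr 1; ext h
  rw [inner_smul_right, inner_smul_right, rieszKernel, finrank_euclideanSpace_fin,
    Real.rpow_neg (norm_nonneg _), real_inner_comm, smul_eq_mul]
  ring

theorem integrable_rieszGradient [Nontrivial 𝔼] {α : ℝ} (hα₀ : 0 < α) (hα₁ : α < 1) {φ : 𝔼 → ℝ}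
    (hφ : IsTestFunction φ) : Integrable (rieszGradient α φ) volume := by
  let b := EuclideanSpace.basisFun (Fin n) ℝ
  have h1 : rieszGradient α φ = fun x => ∑ i, inner ℝ (b i) (rieszGradient α φ x) • b i := by
    ext1 x
    exact (b.sum_repr' _).symm
  rw [h1]
  refine integrable_finsetSum _ fun i _ => Integrable.smul_const ?_ _
  simp only [inner_rieszGradient hα₀ hα₁ hφ]
  exact (exists_hasL1Modulus_diffOp hφ.1 hφ.2
    (isDifferenceKernel_rieszKernel hα₀ hα₁ _)).1.const_mul _

end RieszGradient

/-! ### From gradients to fractional gradients -/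

section FromGradient

variable {n : ℕ}

local notation "𝔼" => EuclideanSpace ℝ (Fin n)

theorem memL1AddLinfty_of_memLp_top {u : 𝔼 → ℝ} (hu : MemLp u ⊤ volume) : MemL1AddLinfty u :=
  ⟨0, u, MemLp.zero, hu, by simp⟩

theorem laplaceKernel_neg (s : ℝ) (h : 𝔼) : laplaceKernel s (-h) = laplaceKernel s h := by
  simp [laplaceKernel]

theorem ae_abs_diffOp_le {ρ : 𝔼 → ℝ} (hρ : IsDifferenceKernel ρ) {v : 𝔼 → ℝ} (hv : Measurable v)
    {M L : ℝ} (hM : ∀ x, ‖v x‖ ≤ M) (hL0 : 0 ≤ L) (hL : ∀ h, ∀ᵐ x, |v (x + h) - v x| ≤ L * ‖h‖) :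
    ∀ᵐ x, ‖diffOp ρ v x‖ ≤ (2 * M + L) * ∫ h, min 1 ‖h‖ * |ρ h| := by
  have hs : MeasurableSet {p : 𝔼 × 𝔼 | |v (p.1 + p.2) - v p.1| ≤ L * ‖p.2‖} :=
    measurableSet_le ((hv.comp (measurable_fst.add measurable_snd)).sub
      (hv.comp measurable_fst)).abs (by fun_prop)
  have hM0 : 0 ≤ M := (norm_nonneg _).trans (hM 0)
  filter_upwards [(Measure.ae_ae_comm (μ := volume) (ν := volume)
    (p := fun x h => |v (x + h) - v x| ≤ L * ‖h‖) hs).2 (.of_forall hL)] with x hx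
  rw [← integral_const_mul]
  refine norm_integral_le_of_norm_le (hρ.integrable.const_mul _) ?_
  filter_upwards [hx] with h hh
  have h1 : ‖v (x + h) - v x‖ ≤ (2 * M + L) * min 1 ‖h‖ := by
    rcases le_total 1 ‖h‖ with h1 | h1
    · rw [min_eq_left h1]
      linarith [norm_sub_le (v (x + h)) (v x), hM x, hM (x + h)]
    · rw [min_eq_right h1, Real.norm_eq_abs]
      nlinarith [norm_nonneg h]
  calc ‖ρ h • (v (x + h) - v x)‖ = |ρ h| * ‖v (x + h) - v x‖ := by
        rw [norm_smul, Real.norm_eq_abs]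
    _ ≤ |ρ h| * ((2 * M + L) * min 1 ‖h‖) := by gcongr
    _ = _ := by ring

theorem IsUnitCubePeriodic.congr {u v : 𝔼 → ℝ} (hu : IsUnitCubePeriodic u) (huv : u =ᵐ[volume] v) :
    IsUnitCubePeriodic v := fun i => by
  have h1 : ∀ᵐ x : 𝔼, u (x + EuclideanSpace.single i 1) = v (x + EuclideanSpace.single i 1) :=
    (measurePreserving_add_right volume _).quasiMeasurePreserving.ae huv
  filter_upwards [hu i, huv, h1] with x h2 h3 h4
  rw [← h4, h2, h3]

theorem IsUnitCubePeriodic.diffOp {v : 𝔼 → ℝ} (hv : IsUnitCubePeriodic v) (ρ : 𝔼 → ℝ) :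
    IsUnitCubePeriodic (diffOp ρ v) := fun i => by
  filter_upwards [hv i] with x hx
  have h1 : ∀ᵐ h : 𝔼, v (x + h + EuclideanSpace.single i 1) = v (x + h) :=
    (measurePreserving_add_left volume x).quasiMeasurePreserving.ae (hv i)
  refine integral_congr_ae ?_
  filter_upwards [h1] with h hh
  rw [hx, add_right_comm, hh]

/-- Every periodic Lipschitz gradient is a fractional gradient: of a multiple of the fractional
Laplacian of order `(1 - α) / 2`. -/
theorem exists_memSInftyPer_of_memW1InftyPer [Nontrivial 𝔼] {α : ℝ} (hα₀ : 0 < α) (hα₁ : α < 1)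
    {v : 𝔼 → ℝ} (hv : MemW1InftyPer v) :
    ∃ u : 𝔼 → ℝ, MemSInftyPer α u ∧ RieszGradientEqGradient α u v := by
  obtain ⟨⟨hvL, g, hvg, hgL⟩, hper⟩ := hv
  obtain ⟨v', M, hv'm, hM0, hM, hvv'⟩ := exists_measurable_bounded_ae_eq hvL
  obtain ⟨g', G, hg'm, hG0, hG, hgg'⟩ := exists_measurable_bounded_ae_eq hgL
  have hvg' : HasWeakGradient v' g' := by
    refine ⟨hvg.1.congr hvv', hvg.2.1.congr hgg', fun φ hφ => ?_⟩
    have h1 : ∫ x, φ x • g' x = ∫ x, φ x • g x := integral_congr_ae <| by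
      filter_upwards [hgg'] with x hx
      rw [hx]
    have h2 : ∫ x, v' x • gradient φ x = ∫ x, v x • gradient φ x := integral_congr_ae <| by
      filter_upwards [hvv'] with x hx
      rw [hx]
    rw [h1, h2, hvg.2.2 φ hφ]
  have hL : ∀ h, ∀ᵐ x, |v' (x + h) - v' x| ≤ G * ‖h‖ := hvg'.ae_abs_sub_le hv'm hM hg'm hG
  have hρ := isDifferenceKernel_laplaceKernel (E := 𝔼) (s := 1 - α) (by linarith) (by linarith)
  obtain ⟨C, hC0, hC⟩ := exists_diffOp_laplaceKernel_diffOp_rieszKernel (E := 𝔼) hα₀ hα₁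
  have hμ := rieszGradientConst_pos (n := n) hα₀ hα₁
  set c := (rieszGradientConst n α * C)⁻¹ with hc
  set u : 𝔼 → ℝ := fun x => c * diffOp (laplaceKernel (1 - α)) v' x with hu
  have hum : Measurable u :=
    (measurable_diffOp hv'm.measurable hρ.measurable).const_mul c
  have huL : MemLp u ⊤ volume := by
    refine memLp_top_of_bound hum.aestronglyMeasurable
      (|c| * ((2 * M + G) * ∫ h : 𝔼, min 1 ‖h‖ * |laplaceKernel (1 - α) h|)) ?_
    filter_upwards [ae_abs_diffOp_le hρ hv'm.measurable hM hG0 hL] with x hx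
    rw [hu, norm_mul, Real.norm_eq_abs c]
    gcongr
  have huper : IsUnitCubePeriodic u := fun i => by
    filter_upwards [(hper.congr hvv').diffOp (laplaceKernel (1 - α)) i] with x hx
    simp only [hu]
    rw [hx]
  have hugrad : HasWeakRieszGradient α u g := by
    refine ⟨memL1AddLinfty_of_memLp_top huL, hvg.2.1, fun φ hφ => ?_⟩
    have hI : Integrable (fun x => u x • rieszGradient α φ x) volume :=
      memLp_one_iff_integrable.1 ((memLp_one_iff_integrable.2
        (integrable_rieszGradient hα₀ hα₁ hφ)).smul huL)
    have hI' : Integrable (fun x => φ x • g x) volume :=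
      hvg.2.1.integrable_smul_left_of_hasCompactSupport hφ.1.continuous hφ.2
    refine ext_inner_left ℝ fun e => ?_
    have hκ := isDifferenceKernel_rieszKernel hα₀ hα₁ e
    obtain ⟨hψ, B, hψB⟩ := exists_hasL1Modulus_diffOp hφ.1 hφ.2 hκ
    rw [inner_neg_right, ← integral_inner hI, ← integral_inner hI']
    simp only [inner_smul_right, inner_rieszGradient hα₀ hα₁ hφ]
    rw [hvg.integral_mul_inner hφ]
    congr 1
    calc ∫ x, v x * fderiv ℝ φ x e = ∫ x, v' x * fderiv ℝ φ x e := integral_congr_ae <| by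
          filter_upwards [hvv'] with x hx
          rw [hx]
      _ = ∫ x, C⁻¹ * (v' x * diffOp (laplaceKernel (1 - α)) (diffOp (rieszKernel α e) φ) x) := by
          congr 1; ext x
          rw [hC φ hφ.1 hφ.2]
          field_simp
      _ = C⁻¹ * ∫ x, diffOp (laplaceKernel (1 - α)) v' x * diffOp (rieszKernel α e) φ x := by
          rw [integral_const_mul, hρ.integral_diffOp_mul (laplaceKernel_neg _) hv'm.measurable hM hL
            hψ hψB]
      _ = ∫ x, u x * (rieszGradientConst n α * diffOp (rieszKernel α e) φ x) := by
          rw [← integral_const_mul]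
          congr 1; ext x
          rw [hu, hc]
          field_simp
  exact ⟨u, ⟨⟨huL, g, hugrad, hgL⟩, huper⟩, g, hugrad, hvg⟩

end FromGradient

/-! ### The normalized Riesz potential of a bounded function -/

section Potential

variable {E : Type*} [NormedAddCommGroup E] [InnerProductSpace ℝ E] [FiniteDimensional ℝ E]
  [MeasurableSpace E] [BorelSpace E]

/-- The kernel `‖z‖^{1-α-d}` of the Riesz potential of order `1 - α`, up to a factor. -/
noncomputable def potentialKernel (α : ℝ) (z : E) : ℝ := ‖z‖ ^ (-((finrank ℝ E : ℝ) + α - 1))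

theorem measurable_potentialKernel (α : ℝ) : Measurable (potentialKernel α : E → ℝ) := by
  unfold potentialKernel; fun_prop

theorem potentialKernel_nonneg (α : ℝ) (z : E) : 0 ≤ potentialKernel α z := by
  unfold potentialKernel; positivity

theorem potentialKernel_neg (α : ℝ) (z : E) : potentialKernel α (-z) = potentialKernel α z := by
  simp [potentialKernel]

theorem abs_rpow_neg_sub_rpow_neg_le {p m a b : ℝ} (hp : 0 ≤ p) (hm : 0 < m) (ha : m ≤ a)
    (hb : m ≤ b) : |a ^ (-p) - b ^ (-p)| ≤ p * m ^ (-p - 1) * |a - b| := by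
  have h := Convex.norm_image_sub_le_of_norm_hasDerivWithin_le (𝕜 := ℝ) (s := Ici m)
    (f := fun r : ℝ => r ^ (-p)) (f' := fun r => -p * r ^ (-p - 1)) (C := p * m ^ (-p - 1))
    (fun r hr => (Real.hasDerivAt_rpow_const (Or.inl (hm.trans_le hr).ne')).hasDerivWithinAt)
    (fun r hr => ?_) (convex_Ici m) hb ha
  · simpa only [Real.norm_eq_abs] using h
  · have hr0 : 0 < r := hm.trans_le hr
    rw [norm_mul, norm_neg, Real.norm_eq_abs, Real.norm_eq_abs, abs_of_nonneg hp,
      abs_of_nonneg (by positivity : 0 ≤ r ^ (-p - 1))]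
    exact mul_le_mul_of_nonneg_left (Real.rpow_le_rpow_of_nonpos hm hr (by linarith)) hp

variable [Nontrivial E]

theorem locallyIntegrable_potentialKernel {α : ℝ} (hα₁ : α < 1) :
    LocallyIntegrable (potentialKernel α : E → ℝ) volume := by
  refine (locallyIntegrable_iff).2 fun k hk => ?_
  obtain ⟨R, hR⟩ := hk.isBounded.subset_closedBall 0
  refine IntegrableOn.mono_set ?_ hR
  rw [← integrable_indicator_iff Metric.isClosed_closedBall.measurableSet]
  refine (integrable_indicator_norm_rpow (E := E) (s := 1 - α) (by linarith) R).congr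
    (.of_forall fun z => ?_)
  beta_reduce
  by_cases hz : ‖z‖ ≤ R
  · rw [indicator_of_mem (mem_Iic.2 hz), indicator_of_mem (mem_closedBall_zero_iff.2 hz),
      potentialKernel]
    congr 1; ring
  · rw [indicator_of_notMem (fun h => hz (mem_Iic.1 h)),
      indicator_of_notMem (fun h => hz (mem_closedBall_zero_iff.1 h))]

/-- The differences of the potential kernel are integrable over the whole space (they decay like
`‖y‖^{-d-α}`), uniformly for bounded increments. -/
theorem exists_integral_abs_potentialKernel_sub_le {α : ℝ} (hα₀ : 0 < α) (hα₁ : α < 1) {R : ℝ}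
    (hR : 0 < R) : ∃ B : ℝ, ∀ x : E, ‖x‖ ≤ R →
      Integrable (fun y => potentialKernel α (y - x) - potentialKernel α y) volume ∧
      ∫ y, |potentialKernel α (y - x) - potentialKernel α y| ≤ B := by
  have hd : (1 : ℝ) ≤ finrank ℝ E := by exact_mod_cast (finrank_pos (R := ℝ) (M := E))
  set p : ℝ := (finrank ℝ E : ℝ) + α - 1 with hp
  have hp0 : 0 < p := by linarith
  -- For `‖y‖ ≤ 2 R` both kernels are estimated separately, on balls where they are integrable; for
  -- larger `y` the difference is controlled by the mean value theorem.
  set near : E → ℝ := fun z =>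
    (Iic (3 * R)).indicator (fun r : ℝ => r ^ (1 - α - (finrank ℝ E : ℝ))) ‖z‖ with hnear
  set far : E → ℝ := fun z =>
    (Ioi (2 * R)).indicator (fun r : ℝ => r ^ (-((finrank ℝ E : ℝ) + α))) ‖z‖ with hfar
  have hnearI : Integrable near volume := integrable_indicator_norm_rpow (by linarith) _
  have hfarI : Integrable far volume := integrable_indicator_Ioi_norm_rpow hα₀ (by positivity)
  have hnear0 : ∀ z, 0 ≤ near z := fun z => indicator_apply_nonneg fun _ => by positivity
  have hfar0 : ∀ z, 0 ≤ far z := fun z => indicator_apply_nonneg fun _ => by positivity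
  set c : ℝ := p * (1 / 2) ^ (-p - 1) * R with hc
  have hc0 : 0 ≤ c := by positivity
  have hpt : ∀ x : E, ‖x‖ ≤ R → ∀ y, |potentialKernel α (y - x) - potentialKernel α y| ≤
      near (y - x) + near y + c * far y := by
    intro x hx y
    rcases le_or_gt ‖y‖ (2 * R) with hy | hy
    · have h1 : near (y - x) = potentialKernel α (y - x) := by
        have : ‖y - x‖ ≤ 3 * R := (norm_sub_le _ _).trans (by linarith)
        simp only [hnear]
        rw [indicator_of_mem (mem_Iic.2 this), potentialKernel]
        congr 1; ring
      have h2 : near y = potentialKernel α y := by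
        simp only [hnear]
        rw [indicator_of_mem (mem_Iic.2 (by linarith)), potentialKernel]
        congr 1; ring
      rw [h1, h2]
      have h3 := abs_sub (potentialKernel α (y - x)) (potentialKernel α y)
      rw [abs_of_nonneg (potentialKernel_nonneg α _), abs_of_nonneg (potentialKernel_nonneg α y)]
        at h3
      linarith [mul_nonneg hc0 (hfar0 y)]
    · have hy0 : 0 < ‖y‖ := by linarith
      have h1 : ‖y‖ / 2 ≤ ‖y - x‖ := by
        have := norm_sub_norm_le y x
        linarith
      have h2 : |‖y - x‖ - ‖y‖| ≤ R := by
        have := abs_norm_sub_norm_le (y - x) y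
        rw [sub_sub_cancel_left, norm_neg] at this
        linarith
      have h3 := abs_rpow_neg_sub_rpow_neg_le hp0.le (by positivity : 0 < ‖y‖ / 2) h1
        (by linarith : ‖y‖ / 2 ≤ ‖y‖)
      have h4 : far y = ‖y‖ ^ (-p - 1) := by
        simp only [hfar]
        rw [indicator_of_mem (mem_Ioi.2 hy)]
        congr 1; rw [hp]; ring
      have h5 : (‖y‖ / 2) ^ (-p - 1) = (1 / 2) ^ (-p - 1) * ‖y‖ ^ (-p - 1) := by
        rw [← Real.mul_rpow (by norm_num) hy0.le]; congr 1; ring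
      rw [h5] at h3
      calc |potentialKernel α (y - x) - potentialKernel α y|
          ≤ p * ((1 / 2) ^ (-p - 1) * ‖y‖ ^ (-p - 1)) * |‖y - x‖ - ‖y‖| := h3
        _ ≤ p * ((1 / 2) ^ (-p - 1) * ‖y‖ ^ (-p - 1)) * R := by gcongr
        _ = c * far y := by rw [hc, h4]; ring
        _ ≤ _ := by linarith [hnear0 (y - x), hnear0 y]
  have hdom : ∀ x : E, Integrable (fun y => near (y - x) + near y + c * far y) volume := fun x =>
    ((hnearI.comp_sub_right x).add hnearI).add (hfarI.const_mul c)
  refine ⟨2 * (∫ z, near z) + c * ∫ z, far z, fun x hx => ?_⟩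
  have hm := measurable_potentialKernel (E := E) α
  have hint : Integrable (fun y => potentialKernel α (y - x) - potentialKernel α y) volume :=
    (hdom x).mono' ((hm.comp (measurable_sub_const x)).sub hm).aestronglyMeasurable
      (.of_forall (hpt x hx))
  refine ⟨hint, (integral_mono hint.abs (hdom x) (hpt x hx)).trans (le_of_eq ?_)⟩
  have e1 := integral_add ((hnearI.comp_sub_right x).add hnearI) (hfarI.const_mul c)
  have e2 := integral_add (hnearI.comp_sub_right x) hnearI
  simp only [Pi.add_apply] at e1
  rw [e1, e2, integral_sub_right_eq_self near x, integral_const_mul]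
  ring

theorem integrable_potentialKernel_sub {α : ℝ} (hα₀ : 0 < α) (hα₁ : α < 1) (x : E) :
    Integrable (fun y => potentialKernel α (y - x) - potentialKernel α y) volume := by
  obtain ⟨B, hB⟩ := exists_integral_abs_potentialKernel_sub_le (E := E) hα₀ hα₁
    (R := ‖x‖ + 1) (by positivity)
  exact (hB x (by linarith)).1

/-- Homogeneity: the differences of the potential kernel grow sublinearly with the increment. -/
theorem integral_abs_potentialKernel_sub_smul (α : ℝ) {r : ℝ} (hr : 0 < r) (x : E) :
    ∫ y, |potentialKernel α (y - r • x) - potentialKernel α y| =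
      r ^ (1 - α) * ∫ y, |potentialKernel α (y - x) - potentialKernel α y| := by
  have h := Measure.integral_comp_smul (volume : Measure E)
    (fun y => |potentialKernel α (y - r • x) - potentialKernel α y|) r
  have hK : ∀ z : E, potentialKernel α (r • z) =
      r ^ (-((finrank ℝ E : ℝ) + α - 1)) * potentialKernel α z := fun z => by
    unfold potentialKernel
    rw [norm_smul, Real.norm_eq_abs, abs_of_pos hr, Real.mul_rpow hr.le (norm_nonneg _)]
  have h2 : (fun y : E => |potentialKernel α (r • y - r • x) - potentialKernel α (r • y)|) =
      fun y => r ^ (-((finrank ℝ E : ℝ) + α - 1)) *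
        |potentialKernel α (y - x) - potentialKernel α y| := by
    ext y
    rw [← smul_sub, hK, hK, ← mul_sub, abs_mul, abs_of_pos (Real.rpow_pos_of_pos hr _)]
  rw [h2, integral_const_mul, abs_of_nonneg (by positivity), smul_eq_mul] at h
  have h3 : r ^ finrank ℝ E * (r ^ finrank ℝ E)⁻¹ = 1 := mul_inv_cancel₀ (by positivity)
  have h4 : r ^ finrank ℝ E * r ^ (-((finrank ℝ E : ℝ) + α - 1)) = r ^ (1 - α) := by
    rw [← Real.rpow_natCast, ← Real.rpow_add hr]; congr 1; ring
  rw [← h4, mul_assoc, h, ← mul_assoc, h3, one_mul]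

/-- The Riesz potential of order `1 - α` of a bounded function, up to a factor, normalized to vanish
at the origin. Subtracting the kernel centred at the origin makes the integral converge. -/
noncomputable def potential (α : ℝ) (u : E → ℝ) (x : E) : ℝ :=
  ∫ y, (potentialKernel α (y - x) - potentialKernel α y) * u y

theorem measurable_potential (α : ℝ) {u : E → ℝ} (hu : Measurable u) :
    Measurable (potential α u) := by
  have hK := measurable_potentialKernel (E := E) α
  have hm : Measurable fun p : E × E =>
      (potentialKernel α (p.2 - p.1) - potentialKernel α p.2) * u p.2 :=
    ((hK.comp (measurable_snd.sub measurable_fst)).sub (hK.comp measurable_snd)).mul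
      (hu.comp measurable_snd)
  exact hm.stronglyMeasurable.integral_prod_right'.measurable

section Bounded

variable {α : ℝ} (hα₀ : 0 < α) (hα₁ : α < 1) {u : E → ℝ} (hu : Measurable u) {M : ℝ}
  (hM : ∀ x, ‖u x‖ ≤ M)

include hα₀ hα₁ hu hM

theorem integrable_potential_integrand (x : E) :
    Integrable (fun y => (potentialKernel α (y - x) - potentialKernel α y) * u y) volume :=
  (integrable_potentialKernel_sub hα₀ hα₁ x).mul_bdd (c := M) hu.aestronglyMeasurable
    (.of_forall hM)

theorem potential_add_sub (x a : E) :
    potential α u (x + a) - potential α u x =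
      ∫ z, (potentialKernel α (z - a) - potentialKernel α z) * u (z + x) := by
  unfold potential
  rw [← integral_sub (integrable_potential_integrand hα₀ hα₁ hu hM _)
    (integrable_potential_integrand hα₀ hα₁ hu hM _), ← integral_add_right_eq_self _ x]
  congr 1; ext z
  rw [add_sub_cancel_right, show z + x - (x + a) = z - a by abel]
  ring

theorem abs_potential_add_sub_le (x a : E) :
    |potential α u (x + a) - potential α u x| ≤
      M * ∫ z, |potentialKernel α (z - a) - potentialKernel α z| := by
  rw [potential_add_sub hα₀ hα₁ hu hM, ← integral_const_mul, ← Real.norm_eq_abs]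
  refine norm_integral_le_of_norm_le
    ((integrable_potentialKernel_sub hα₀ hα₁ a).abs.const_mul M) (.of_forall fun z => ?_)
  rw [norm_mul, Real.norm_eq_abs, mul_comm]
  gcongr
  exact hM _

/-- The potential of an `a`-periodic function is `a`-periodic: its increment `D` over the period is
itself periodic, so the increment over `N` periods is `N * D`; by homogeneity of the kernel it is
at most of order `N ^ (1 - α)`. -/
theorem potential_add_period {a : E} (ha : ∀ᵐ x, u (x + a) = u x) (x : E) :
    potential α u (x + a) = potential α u x := by
  set D := potential α u (x + a) - potential α u x with hD
  set Φ := ∫ z, |potentialKernel α (z - a) - potentialKernel α z| with hΦ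
  have hstep : ∀ y, potential α u (y + a + a) - potential α u (y + a) =
      potential α u (y + a) - potential α u y := by
    intro y
    rw [potential_add_sub hα₀ hα₁ hu hM, potential_add_sub hα₀ hα₁ hu hM]
    have h1 : ∀ᵐ z, u (z + y + a) = u (z + y) :=
      (measurePreserving_add_right volume y).quasiMeasurePreserving.ae ha
    refine integral_congr_ae ?_
    filter_upwards [h1] with z hz
    rw [← add_assoc, hz]
  have hD' : ∀ N : ℕ, potential α u (x + (N : ℝ) • a + a) - potential α u (x + (N : ℝ) • a) = D := by
    intro N
    induction N with
    | zero => simp [hD]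
    | succ N ih =>
      have h1 : x + ((N + 1 : ℕ) : ℝ) • a = x + (N : ℝ) • a + a := by
        push_cast; rw [add_smul, one_smul, add_assoc]
      rw [h1, hstep, ih]
  have hN : ∀ N : ℕ, potential α u (x + (N : ℝ) • a) - potential α u x = N * D := by
    intro N
    induction N with
    | zero => simp
    | succ N ih =>
      have h1 : x + ((N + 1 : ℕ) : ℝ) • a = x + (N : ℝ) • a + a := by
        push_cast; rw [add_smul, one_smul, add_assoc]
      rw [h1]
      push_cast
      linarith [hD' N]
  have hbound : ∀ N : ℕ, 1 ≤ N → |D| ≤ M * Φ * (N : ℝ) ^ (-α) := by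
    intro N hN1
    have hN0 : (0 : ℝ) < N := by exact_mod_cast hN1
    have h1 := abs_potential_add_sub_le hα₀ hα₁ hu hM x ((N : ℝ) • a)
    rw [hN, integral_abs_potentialKernel_sub_smul α hN0, ← hΦ, abs_mul, abs_of_pos hN0] at h1
    have h2 : (N : ℝ) ^ (1 - α) = N * (N : ℝ) ^ (-α) := by
      rw [sub_eq_add_neg, Real.rpow_add hN0, Real.rpow_one]
    rw [h2] at h1
    refine le_of_mul_le_mul_left (h1.trans (le_of_eq ?_)) hN0
    ring
  have hlim : Tendsto (fun N : ℕ => M * Φ * (N : ℝ) ^ (-α)) atTop (𝓝 0) := by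
    have := ((tendsto_rpow_neg_atTop hα₀).comp tendsto_natCast_atTop_atTop).const_mul (M * Φ)
    simpa using this
  have hD0 : |D| ≤ 0 := ge_of_tendsto hlim <| by
    filter_upwards [eventually_ge_atTop 1] with N hN1 using hbound N hN1
  have := abs_nonpos_iff.1 hD0
  linarith [hD]

theorem exists_abs_potential_le {R : ℝ} (hR : 0 < R) :
    ∃ B : ℝ, 0 ≤ B ∧ ∀ x, ‖x‖ ≤ R → |potential α u x| ≤ M * B := by
  obtain ⟨B, hB⟩ := exists_integral_abs_potentialKernel_sub_le (E := E) hα₀ hα₁ hR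
  have hM0 : 0 ≤ M := (norm_nonneg _).trans (hM 0)
  refine ⟨B, (integral_nonneg fun y => abs_nonneg _).trans (hB 0 (by simpa using hR.le)).2,
    fun x hx => ?_⟩
  have h1 := abs_potential_add_sub_le hα₀ hα₁ hu hM 0 x
  have h2 : potential α u 0 = 0 := by simp [potential]
  rw [zero_add, h2, sub_zero] at h1
  exact h1.trans (by gcongr; exact (hB x hx).2)

/-- A potential that is periodic with respect to a basis is bounded. -/
theorem exists_abs_potential_le_of_periodic {ι : Type*} [Fintype ι] (b : Basis ι ℝ E)
    (hb : ∀ i, ∀ᵐ x, u (x + b i) = u x) : ∃ C : ℝ, ∀ x, |potential α u x| ≤ C := by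
  obtain ⟨B, -, hB⟩ := exists_abs_potential_le hα₀ hα₁ hu hM
    (R := ∑ i, ‖b i‖ + 1) (by positivity)
  refine ⟨M * B, fun x => ?_⟩
  have hspan : ∀ w ∈ Submodule.span ℤ (range b), ∀ y, potential α u (y + w) = potential α u y := by
    intro w hw
    induction hw using Submodule.span_induction with
    | mem w hw =>
      obtain ⟨i, rfl⟩ := hw
      exact potential_add_period hα₀ hα₁ hu hM (hb i)
    | zero => simp
    | add w w' _ _ h h' => intro y; rw [← add_assoc, h', h]
    | smul k w _ h => exact Function.Periodic.zsmul h k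
  have h1 : potential α u (ZSpan.fract b x) = potential α u x := by
    rw [← hspan _ (ZSpan.floor b x).2 (ZSpan.fract b x), ZSpan.fract_apply, sub_add_cancel]
  rw [← h1]
  exact hB _ ((ZSpan.norm_fract_le b x).trans (by linarith))

/-- Pairing the potential with a function of mean zero. -/
theorem integral_potential_mul {ψ : E → ℝ} (hψ : Continuous ψ) (hψc : HasCompactSupport ψ)
    (hψ0 : ∫ x, ψ x = 0) :
    ∫ x, potential α u x * ψ x = ∫ y, u y * ∫ z, potentialKernel α z * ψ (y + z) := by
  have hK := measurable_potentialKernel (E := E) α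
  have hM0 : 0 ≤ M := (norm_nonneg _).trans (hM 0)
  obtain ⟨R, hR⟩ := hψc.isCompact.isBounded.subset_closedBall 0
  obtain ⟨B, hB⟩ := exists_integral_abs_potentialKernel_sub_le (E := E) hα₀ hα₁
    (R := max R 1) (by positivity)
  have hψI : Integrable ψ volume := hψ.integrable_of_hasCompactSupport hψc
  have hm : Measurable fun p : E × E =>
      (potentialKernel α (p.2 - p.1) - potentialKernel α p.2) * u p.2 * ψ p.1 :=
    (((hK.comp (measurable_snd.sub measurable_fst)).sub (hK.comp measurable_snd)).mul
      (hu.comp measurable_snd)).mul (hψ.measurable.comp measurable_fst)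
  have hprod : Integrable (fun p : E × E =>
      (potentialKernel α (p.2 - p.1) - potentialKernel α p.2) * u p.2 * ψ p.1)
      (volume.prod volume) := by
    rw [integrable_prod_iff hm.aestronglyMeasurable]
    refine ⟨.of_forall fun x =>
      (integrable_potential_integrand hα₀ hα₁ hu hM x).mul_const (ψ x), ?_⟩
    refine (hψI.norm.const_mul (M * B)).mono' (hm.norm.stronglyMeasurable.integral_prod_right'
      |>.aestronglyMeasurable) (.of_forall fun x => ?_)
    rw [Real.norm_eq_abs, abs_of_nonneg (integral_nonneg fun y => norm_nonneg _)]
    by_cases hx : ψ x = 0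
    · simp [hx]
    · have hxR : ‖x‖ ≤ max R 1 := by
        have := hR (subset_tsupport ψ hx)
        rw [mem_closedBall_zero_iff] at this
        exact this.trans (le_max_left _ _)
      have hpos : 0 ≤ ‖ψ x‖ := norm_nonneg _
      calc ∫ y, ‖(potentialKernel α (y - x) - potentialKernel α y) * u y * ψ x‖
          ≤ ∫ y, |potentialKernel α (y - x) - potentialKernel α y| * (M * ‖ψ x‖) := by
            refine integral_mono
              ((integrable_potential_integrand hα₀ hα₁ hu hM x).mul_const (ψ x)).norm
              ((hB x hxR).1.abs.mul_const _) fun y => ?_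
            simp only [norm_mul, Real.norm_eq_abs (potentialKernel α (y - x) - _), mul_assoc]
            gcongr
            exact hM y
        _ ≤ B * (M * ‖ψ x‖) := by
            rw [integral_mul_const]
            gcongr
            exact (hB x hxR).2
        _ = _ := by ring
  have hinner : ∀ y : E, Integrable (fun z => potentialKernel α z * ψ (y + z)) volume := fun y =>
    (locallyIntegrable_potentialKernel hα₁).integrable_smul_right_of_hasCompactSupport
      (g := fun z => ψ (y + z)) (by fun_prop)
      (hψc.comp_homeomorph (Homeomorph.addLeft y))
  calc ∫ x, potential α u x * ψ x
      = ∫ x, ∫ y, (potentialKernel α (y - x) - potentialKernel α y) * u y * ψ x := by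
        congr 1; ext x
        rw [potential, integral_mul_const]
    _ = ∫ y, ∫ x, (potentialKernel α (y - x) - potentialKernel α y) * u y * ψ x :=
        integral_integral_swap hprod
    _ = _ := by
        congr 1; ext y
        have h1 : ∫ x, (potentialKernel α (y - x) - potentialKernel α y) * u y * ψ x =
            u y * ∫ z, (potentialKernel α z * ψ (y + z) - potentialKernel α y * ψ (y + z)) := by
          rw [← integral_const_mul, ← integral_add_left_eq_self _ y]
          congr 1; ext z
          rw [sub_add_cancel_left, potentialKernel_neg]
          ring
        rw [h1, integral_sub (hinner y) ((hψI.comp_add_left y).const_mul _), integral_const_mul,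
          integral_add_left_eq_self ψ y, hψ0, mul_zero, sub_zero]

end Bounded

end Potential

/-! ### The Riesz potential of a derivative -/

section IntegrationByParts

variable {E : Type*} [NormedAddCommGroup E] [InnerProductSpace ℝ E] [FiniteDimensional ℝ E]
  [MeasurableSpace E] [BorelSpace E]

theorem hasFDerivAt_norm_sq_add_rpow {ε : ℝ} (hε : 0 < ε) (q : ℝ) (z : E) :
    HasFDerivAt (fun z : E => (‖z‖ ^ 2 + ε) ^ q)
      ((q * (‖z‖ ^ 2 + ε) ^ (q - 1)) • ((2 : ℝ) • innerSL ℝ z)) z := by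
  have h1 : HasFDerivAt (fun z : E => ‖z‖ ^ 2 + ε) ((2 : ℝ) • innerSL ℝ z) z := by
    have := (hasStrictFDerivAt_norm_sq z).hasFDerivAt.add_const ε
    rwa [← Nat.cast_smul_eq_nsmul ℝ, Nat.cast_ofNat] at this
  exact h1.rpow_const (Or.inl (by positivity))

/-- Integration by parts against a smooth even radial kernel. As the derivative of the kernel is
odd, the value `φ y` can be subtracted from `φ (y + z)`. -/
theorem integral_norm_sq_add_rpow_mul_fderiv {φ : E → ℝ} (hφ : ContDiff ℝ ∞ φ)
    (hc : HasCompactSupport φ) {ε : ℝ} (hε : 0 < ε) (q : ℝ) (y e : E)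
    (hint : Integrable (fun z : E => (2 * q * (‖z‖ ^ 2 + ε) ^ (q - 1) * inner ℝ z e) *
      (φ (y + z) - φ y)) volume) :
    ∫ z, (‖z‖ ^ 2 + ε) ^ q * fderiv ℝ φ (y + z) e =
      -∫ z, (2 * q * (‖z‖ ^ 2 + ε) ^ (q - 1) * inner ℝ z e) * (φ (y + z) - φ y) := by
  set A : E → ℝ := fun z => 2 * q * (‖z‖ ^ 2 + ε) ^ (q - 1) * inner ℝ z e with hA
  have hpow : ∀ r : ℝ, Continuous fun z : E => (‖z‖ ^ 2 + ε) ^ r := fun r =>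
    (by fun_prop : Continuous fun z : E => ‖z‖ ^ 2 + ε).rpow_const
      fun z => Or.inl (by positivity)
  have hAc : Continuous A := (continuous_const.mul (hpow _)).mul (by fun_prop)
  have hφy : ContDiff ℝ ∞ fun z => φ (y + z) := hφ.comp (contDiff_const.add contDiff_id)
  have hcy : HasCompactSupport fun z => φ (y + z) := hc.comp_homeomorph (Homeomorph.addLeft y)
  have hfd : ∀ z, fderiv ℝ (fun z : E => (‖z‖ ^ 2 + ε) ^ q) z e = A z := fun z => by
    rw [(hasFDerivAt_norm_sq_add_rpow hε q z).fderiv]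
    simp only [hA, smul_apply, innerSL_apply_apply, smul_eq_mul]
    ring
  have hfd' : ∀ z, fderiv ℝ (fun z => φ (y + z)) z e = fderiv ℝ φ (y + z) e := fun z => by
    rw [fderiv_comp_add_left]
  have hI1 : Integrable (fun z => A z * φ (y + z)) volume :=
    (hAc.mul hφy.continuous).integrable_of_hasCompactSupport hcy.mul_left
  have hI2 : Integrable (fun z : E => (‖z‖ ^ 2 + ε) ^ q * φ (y + z)) volume :=
    ((hpow q).mul hφy.continuous).integrable_of_hasCompactSupport hcy.mul_left
  have hdc : Continuous fun z => fderiv ℝ φ (y + z) e :=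
    ((hφ.continuous_fderiv (by simp)).comp (by fun_prop : Continuous fun z => y + z)).clm_apply
      continuous_const
  have hdcs : HasCompactSupport fun z => fderiv ℝ φ (y + z) e :=
    ((hc.fderiv ℝ).comp_homeomorph (Homeomorph.addLeft y)).comp_left
      (g := fun T : E →L[ℝ] ℝ => T e) rfl
  have hI3 : Integrable (fun z : E => (‖z‖ ^ 2 + ε) ^ q * fderiv ℝ φ (y + z) e) volume :=
    ((hpow q).mul hdc).integrable_of_hasCompactSupport hdcs.mul_left
  have hibp := integral_mul_fderiv_eq_neg_fderiv_mul_of_integrable (μ := volume) (v := e)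
    (f := fun z : E => (‖z‖ ^ 2 + ε) ^ q) (g := fun z => φ (y + z))
    (by simpa only [hfd] using hI1) (by simpa only [hfd'] using hI3) hI2
    (fun z _ => (hasFDerivAt_norm_sq_add_rpow hε q z).differentiableAt)
    (fun z _ => hφy.differentiable (by simp) z)
  simp only [hfd, hfd'] at hibp
  rw [hibp]
  congr 1
  -- By oddness the integral vanishes even if `A` is not integrable, where it is zero by convention;
  -- if `φ y ≠ 0`, integrability follows from `hI1` and `hint`.
  have hodd : ∫ z, A z * φ y = 0 := by
    have h1 := integral_neg_eq_self (fun z => A z * φ y) volume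
    have h2 : (fun z => A (-z) * φ y) = fun z => -(A z * φ y) := by
      ext z
      simp only [hA, norm_neg, inner_neg_left]
      ring
    rw [h2, integral_neg] at h1
    linarith
  have h3 : ∫ z, (A z * φ (y + z) - A z * (φ (y + z) - φ y)) =
      (∫ z, A z * φ (y + z)) - ∫ z, A z * (φ (y + z) - φ y) := integral_sub hI1 hint
  have h4 : ∀ z, A z * φ (y + z) - A z * (φ (y + z) - φ y) = A z * φ y := fun z => by ring
  simp only [h4] at h3
  rw [hodd] at h3
  linarith

variable [Nontrivial E]

/-- The Riesz potential of order `1 - α` of a directional derivative of `φ` is, up to a factor, the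
corresponding component of the Riesz fractional gradient of `φ`. -/
theorem integral_potentialKernel_mul_fderiv {α : ℝ} (hα₀ : 0 < α) (hα₁ : α < 1) {φ : E → ℝ}
    (hφ : ContDiff ℝ ∞ φ) (hc : HasCompactSupport φ) (y e : E) :
    ∫ z, potentialKernel α z * fderiv ℝ φ (y + z) e =
      ((finrank ℝ E : ℝ) + α - 1) * diffOp (rieszKernel α e) φ y := by
  have hd : (1 : ℝ) ≤ finrank ℝ E := by exact_mod_cast (finrank_pos (R := ℝ) (M := E))
  set p : ℝ := (finrank ℝ E : ℝ) + α - 1 with hp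
  have hp0 : 0 < p := by linarith
  set q : ℝ := -p / 2 with hq
  have hκ := isDifferenceKernel_rieszKernel hα₀ hα₁ e
  have hne : ∀ᵐ z : E, z ≠ 0 := compl_mem_ae_iff.2 (measure_singleton 0)
  have hpow : ∀ (r ε : ℝ), 0 < ε → Continuous fun z : E => (‖z‖ ^ 2 + ε) ^ r := fun r ε hε =>
    (by fun_prop : Continuous fun z : E => ‖z‖ ^ 2 + ε).rpow_const
      fun z => Or.inl (by positivity)
  have hle : ∀ {r : ℝ}, r ≤ 0 → ∀ {ε : ℝ}, 0 < ε → ∀ {z : E}, z ≠ 0 →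
      (‖z‖ ^ 2 + ε) ^ r ≤ ‖z‖ ^ (2 * r) := fun {r} hr {ε} hε {z} hz => by
    have hz0 : 0 < ‖z‖ := norm_pos_iff.2 hz
    rw [Real.rpow_mul hz0.le, Real.rpow_two]
    exact Real.rpow_le_rpow_of_nonpos (by positivity) (by linarith) hr
  have hlim : ∀ (r : ℝ) {z : E}, z ≠ 0 →
      Tendsto (fun k : ℕ => (‖z‖ ^ 2 + 1 / ((k : ℝ) + 1)) ^ r) atTop (𝓝 (‖z‖ ^ (2 * r))) :=
    fun r {z} hz => by
      have hz0 : 0 < ‖z‖ := norm_pos_iff.2 hz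
      have h1 : Tendsto (fun k : ℕ => ‖z‖ ^ 2 + 1 / ((k : ℝ) + 1)) atTop (𝓝 (‖z‖ ^ 2)) := by
        simpa using tendsto_one_div_add_atTop_nhds_zero_nat.const_add (‖z‖ ^ 2)
      rw [Real.rpow_mul hz0.le, Real.rpow_two]
      exact h1.rpow_const (Or.inl (by positivity))
  have hKq : ∀ z : E, ‖z‖ ^ (2 * q) = potentialKernel α z := fun z => by
    rw [potentialKernel, hq]; congr 1; ring
  -- The derivative of the kernel in direction `e` is `-p` times the kernel of the fractional
  -- gradient.
  have hRq : ∀ z : E, z ≠ 0 →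
      2 * q * ‖z‖ ^ (2 * (q - 1)) * inner ℝ z e = -p * rieszKernel α e z := fun z hz => by
    have hz0 : 0 < ‖z‖ := norm_pos_iff.2 hz
    have h1 : 2 * (q - 1) = -((finrank ℝ E : ℝ) + α) - 1 := by rw [hq, hp]; ring
    rw [h1, Real.rpow_sub_one hz0.ne', rieszKernel, hq]
    field_simp
  have hdc : Continuous fun z => fderiv ℝ φ (y + z) e :=
    ((hφ.continuous_fderiv (by simp)).comp (by fun_prop : Continuous fun z => y + z)).clm_apply
      continuous_const
  have hdcs : HasCompactSupport fun z => fderiv ℝ φ (y + z) e :=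
    ((hc.fderiv ℝ).comp_homeomorph (Homeomorph.addLeft y)).comp_left
      (g := fun T : E →L[ℝ] ℝ => T e) rfl
  have hI : Integrable (fun z => potentialKernel α z * fderiv ℝ φ (y + z) e) volume :=
    (locallyIntegrable_potentialKernel hα₁).integrable_smul_right_of_hasCompactSupport hdc hdcs
  have hJ := hκ.integrable_mul_sub hφ hc y
  have hbound : ∀ {ε : ℝ}, 0 < ε → ∀ᵐ z : E,
      ‖(2 * q * (‖z‖ ^ 2 + ε) ^ (q - 1) * inner ℝ z e) * (φ (y + z) - φ y)‖ ≤
        p * ‖rieszKernel α e z * (φ (y + z) - φ y)‖ := fun {ε} hε => by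
    filter_upwards [hne] with z hz
    rw [norm_mul, norm_mul (rieszKernel α e z), ← mul_assoc]
    gcongr
    have h1 : p * ‖rieszKernel α e z‖ = ‖2 * q * ‖z‖ ^ (2 * (q - 1)) * inner ℝ z e‖ := by
      rw [hRq z hz, norm_mul, norm_neg, Real.norm_of_nonneg hp0.le]
    rw [h1, norm_mul, norm_mul, norm_mul (2 * q * ‖z‖ ^ (2 * (q - 1))), norm_mul (2 * q) (‖z‖ ^ _),
      Real.norm_of_nonneg (by positivity : 0 ≤ (‖z‖ ^ 2 + ε) ^ (q - 1)),
      Real.norm_of_nonneg (by positivity : 0 ≤ ‖z‖ ^ (2 * (q - 1)))]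
    gcongr
    exact hle (by rw [hq]; linarith) hε hz
  have hmeas : ∀ {ε : ℝ}, 0 < ε → AEStronglyMeasurable (fun z : E =>
      (2 * q * (‖z‖ ^ 2 + ε) ^ (q - 1) * inner ℝ z e) * (φ (y + z) - φ y)) volume :=
    fun {ε} hε => by
      have := hφ.continuous
      exact (((continuous_const.mul (hpow _ ε hε)).mul (by fun_prop)).mul
        (by fun_prop)).aestronglyMeasurable
  have hε : ∀ k : ℕ, (0 : ℝ) < 1 / ((k : ℝ) + 1) := fun k => by positivity
  have hL := tendsto_integral_of_dominated_convergence (μ := volume)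
    (F := fun (k : ℕ) (z : E) => (‖z‖ ^ 2 + 1 / ((k : ℝ) + 1)) ^ q * fderiv ℝ φ (y + z) e)
    (f := fun z => potentialKernel α z * fderiv ℝ φ (y + z) e)
    (fun z => ‖potentialKernel α z * fderiv ℝ φ (y + z) e‖)
    (fun k => ((hpow q _ (hε k)).mul hdc).aestronglyMeasurable) hI.norm
    (fun k => by
      filter_upwards [hne] with z hz
      rw [norm_mul, norm_mul]
      gcongr
      rw [Real.norm_of_nonneg (by positivity), Real.norm_of_nonneg (potentialKernel_nonneg α z),
        ← hKq]
      exact hle (by rw [hq]; linarith) (hε k) hz)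
    (by
      filter_upwards [hne] with z hz
      rw [← hKq]
      exact (hlim q hz).mul_const _)
  have hR := tendsto_integral_of_dominated_convergence (μ := volume)
    (F := fun (k : ℕ) (z : E) =>
      (2 * q * (‖z‖ ^ 2 + 1 / ((k : ℝ) + 1)) ^ (q - 1) * inner ℝ z e) * (φ (y + z) - φ y))
    (f := fun z => -p * (rieszKernel α e z * (φ (y + z) - φ y)))
    (fun z => p * ‖rieszKernel α e z * (φ (y + z) - φ y)‖)
    (fun k => hmeas (hε k)) (hJ.norm.const_mul p) (fun k => hbound (hε k))
    (by
      filter_upwards [hne] with z hz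
      rw [← mul_assoc, ← hRq z hz]
      exact (((hlim (q - 1) hz).const_mul (2 * q)).mul_const _).mul_const _)
  have heq : ∀ k : ℕ, ∫ z, (‖z‖ ^ 2 + 1 / ((k : ℝ) + 1)) ^ q * fderiv ℝ φ (y + z) e =
      -∫ z, (2 * q * (‖z‖ ^ 2 + 1 / ((k : ℝ) + 1)) ^ (q - 1) * inner ℝ z e) *
        (φ (y + z) - φ y) := fun k =>
    integral_norm_sq_add_rpow_mul_fderiv hφ hc (hε k) q y e
      ((hJ.norm.const_mul p).mono' (hmeas (hε k)) (hbound (hε k)))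
  simp only [heq] at hL
  have := tendsto_nhds_unique hL hR.neg
  rw [this, integral_const_mul, neg_mul, neg_neg]
  rfl

end IntegrationByParts

/-! ### From fractional gradients to gradients -/

section FromRieszGradient

variable {n : ℕ}

local notation "𝔼" => EuclideanSpace ℝ (Fin n)

/-- Every periodic bounded fractional gradient is a gradient: of a multiple of the normalized Riesz
potential of order `1 - α`. -/
theorem exists_memW1InftyPer_of_memSInftyPer [Nontrivial 𝔼] {α : ℝ} (hα₀ : 0 < α) (hα₁ : α < 1)
    {u : 𝔼 → ℝ} (hu : MemSInftyPer α u) :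
    ∃ v : 𝔼 → ℝ, MemW1InftyPer v ∧ RieszGradientEqGradient α u v := by
  obtain ⟨⟨huL, w, huw, hwL⟩, hper⟩ := hu
  obtain ⟨u', M, hu'm, hM0, hM, huu'⟩ := exists_measurable_bounded_ae_eq huL
  have hper' := hper.congr huu'
  have hd : (1 : ℝ) ≤ finrank ℝ 𝔼 := by exact_mod_cast (finrank_pos (R := ℝ) (M := 𝔼))
  set p : ℝ := (finrank ℝ 𝔼 : ℝ) + α - 1 with hp
  have hp0 : p ≠ 0 := by
    have : 0 < p := by linarith
    exact this.ne'
  set c := rieszGradientConst n α / p with hc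
  set v : 𝔼 → ℝ := fun x => c * potential α u' x with hv
  have hvm : Measurable v := (measurable_potential α hu'm.measurable).const_mul c
  have hvper : IsUnitCubePeriodic v := fun i => .of_forall fun x => by
    simp only [hv]
    rw [potential_add_period hα₀ hα₁ hu'm.measurable hM (hper' i)]
  have hvL : MemLp v ⊤ volume := by
    obtain ⟨C, hC⟩ := exists_abs_potential_le_of_periodic hα₀ hα₁ hu'm.measurable hM
      (EuclideanSpace.basisFun (Fin n) ℝ).toBasis (fun i => by simpa using hper' i)
    refine memLp_top_of_bound hvm.aestronglyMeasurable (|c| * C) (.of_forall fun x => ?_)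
    rw [hv, norm_mul, Real.norm_eq_abs, Real.norm_eq_abs]
    gcongr
    exact hC x
  have hvloc : LocallyIntegrable v volume := hvL.locallyIntegrable (by simp)
  have hvw : HasWeakGradient v w := by
    refine ⟨hvloc, huw.2.1, fun φ hφ => ?_⟩
    rw [huw.2.2 φ hφ, neg_inj]
    have hI1 : Integrable (fun x => u x • rieszGradient α φ x) volume :=
      memLp_one_iff_integrable.1 ((memLp_one_iff_integrable.2
        (integrable_rieszGradient hα₀ hα₁ hφ)).smul huL)
    have hI2 : Integrable (fun x => v x • gradient φ x) volume :=
      hvloc.integrable_smul_right_of_hasCompactSupport hφ.continuous_gradient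
        hφ.hasCompactSupport_gradient
    refine ext_inner_left ℝ fun e => ?_
    rw [← integral_inner hI1, ← integral_inner hI2]
    simp only [inner_smul_right, inner_rieszGradient hα₀ hα₁ hφ]
    have hgrad : ∀ x, inner ℝ e (gradient φ x) = fderiv ℝ φ x e := fun x => by
      rw [real_inner_comm, inner_gradient_left]
    simp only [hgrad]
    have hmean : ∫ x, fderiv ℝ φ x e = 0 := by
      have hdI : Integrable (fun x => fderiv ℝ φ x e) volume :=
        (hφ.continuous_fderiv_apply e).integrable_of_hasCompactSupport
          (hφ.hasCompactSupport_fderiv_apply e)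
      have h1 := integral_mul_fderiv_eq_neg_fderiv_mul_of_integrable (μ := volume) (v := e)
        (f := fun _ : 𝔼 => (1 : ℝ)) (g := φ) (by simp)
        (by simpa using hdI)
        (by simpa using hφ.1.continuous.integrable_of_hasCompactSupport hφ.2)
        (fun x _ => differentiableAt_const _) (fun x _ => hφ.1.differentiable (by simp) x)
      simpa using h1
    symm
    calc ∫ x, v x * fderiv ℝ φ x e = c * ∫ x, potential α u' x * fderiv ℝ φ x e := by
          rw [← integral_const_mul]
          simp only [hv, mul_assoc]
      _ = c * ∫ x, u' x * (p * diffOp (rieszKernel α e) φ x) := by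
          rw [integral_potential_mul hα₀ hα₁ hu'm.measurable hM (hφ.continuous_fderiv_apply e)
            (hφ.hasCompactSupport_fderiv_apply e) hmean]
          simp only [integral_potentialKernel_mul_fderiv hα₀ hα₁ hφ.1 hφ.2, ← hp]
      _ = ∫ x, u x * (rieszGradientConst n α * diffOp (rieszKernel α e) φ x) := by
          rw [← integral_const_mul]
          refine integral_congr_ae ?_
          filter_upwards [huu'] with x hx
          rw [hx, hc]
          field_simp
  exact ⟨v, ⟨⟨hvL, w, hvw, hwL⟩, hvper⟩, w, huw, hvw⟩

end FromRieszGradient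

end FractionalGradient

theorem proposition3p3 (n : ℕ) (hn : 1 ≤ n) (α : ℝ) (hα₀ : 0 < α) (hα₁ : α < 1) :
    (∀ v : EuclideanSpace ℝ (Fin n) → ℝ, FractionalGradient.MemW1InftyPer v →
      ∃ u : EuclideanSpace ℝ (Fin n) → ℝ, FractionalGradient.MemSInftyPer α u ∧
        FractionalGradient.RieszGradientEqGradient α u v) ∧
    (∀ u : EuclideanSpace ℝ (Fin n) → ℝ, FractionalGradient.MemSInftyPer α u →
      ∃ v : EuclideanSpace ℝ (Fin n) → ℝ, FractionalGradient.MemW1InftyPer v ∧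
        FractionalGradient.RieszGradientEqGradient α u v) := by
  have : Nontrivial (EuclideanSpace ℝ (Fin n)) :=
    Module.nontrivial_of_finrank_pos (R := ℝ) (by rw [finrank_euclideanSpace_fin]; omega)
  exact ⟨fun v hv => FractionalGradient.exists_memSInftyPer_of_memW1InftyPer hα₀ hα₁ hv,
    fun u hu => FractionalGradient.exists_memW1InftyPer_of_memSInftyPer hα₀ hα₁ hu⟩
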